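/- **Theorem (running time).** Algorithm Auxiliary-3ecc-subgraphs, described below, takes $O(|V|+|E|)$ time: there is an absolute constant $C$ such that for every connected multigraph $G=(V,E)$ with vertices $1,\dots,|V|$ and edges numbered $1,\dots,|E|$, every root $r\in V$ and every adjacency list representation of $G$ (for each $w\in V$ a linked list $L[w]$, in any order, with one entry $(e,u)$ for each edge $e$ joining $w$ to a vertex $u$), the algorithm terminates after at most $C\,(|V|+|E|)$ steps. *Machine.* A random access machine with finitely many arrays of words (natural numbers), local variables and recursive procedures. Each constant, variable access, memory access, addition, subtraction, comparison, Boolean operation, assignment, test, passing of an argument or result, procedure call, and writing of one word on the output tape counts one step. Nothing is assumed about the initial contents of the memory outside the input. *Data.* For each vertex $w$ the algorithm keeps its depth-first number $dfs(w)$, the numbers $deg(w)$ and $nd(w)$, the pointers $parent(w)$ and $next(w)$, a directed back-edge $ear(w)=(s\curvearrowright t)$, with source $s(ear(w))=s$ and sink $t(ear(w))=t$, or $ear(w)=\infty$, a linked list $Inc(w)$, and a set $\alpha(w)$ of edges, stored as a linked list with pointers to its first and last cells, so that edges are added and sets are united by pointer operations. Adding $\infty$ to $\alpha(w)$ has no effect.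 $b$ is a descendant of $a$ if $dfs(a)\le dfs(b)<dfs(a)+nd(a)$. Back-edges are compared by $(p\curvearrowright q)\lessdot(x\curvearrowright y)$ iff $dfs(q)<dfs(y)$, or $q=y$, $dfs(p)<dfs(x)$ and $x$ is not a descendant of $p$, or $q=y$, $p\neq x$ and $p$ is a descendant of $x$. In a comparison made while $w$ is processed, $(x\curvearrowright y)\lessdot\infty$ iff $dfs(y)<dfs(w)$, $\infty\lessdot(x\curvearrowright y)$ otherwise, and $\infty\not\lessdot\infty$. Write $f\mathrel{\underline{\lessdot}}g$ for $\neg(g\lessdot f)$. *Main program.* For all $w\in V$ set $dfs(w):=0$, $deg(w):=0$, $nd(w):=1$, $parent(w):=\bot$, $\alpha(w):=\emptyset$, $Inc(w):=\emptyset$; set $cnt:=1$; call Construct$(r,\bot,\bot)$; output $\alpha(r)$. (Output writes the edges of the set one after the other, and then an end mark.) *Construct$(w,v,e_0)$*, where $e_0$ is the tree edge joining $w$ to its parent $v$. Set $dfs(w):=cnt$, $cnt:=cnt+1$, $parent(w):=v$, $next(w):=\bot$, $ear(w):=\infty$. For each entry $(e,u)$ of $L[w]$ set $deg(w):=deg(w)+1$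 and do the following. 1. If $dfs(u)=0$: $Null:=\mathrm{false}$; call Construct$(u,w,e)$; $nd(w):=nd(w)+nd(u)$; if $deg(u)\le 2$ call Gen-aux-edges$(w,u,Null)$, which may change $u$ and $Null$. Then, if $ear(w)\mathrel{\underline{\lessdot}}ear(u)$, call Absorb-ear$(w,u,Null)$ and, if $Null$, $ear(u)\ne\infty$ and $dfs(t(ear(u)))<dfs(w)$, add $ear(u)$ to $\alpha(w)$; otherwise call Absorb-ear$(w,next(w),\mathrm{false})$, set $next(w):=\bot$ if $Null$ and $next(w):=u$ if not, and set $ear(w):=ear(u)$. 2. Otherwise, if $dfs(u)<dfs(w)$ and $e\ne e_0$: if $(w\curvearrowright u)\lessdot ear(w)$, call Absorb-ear$(w,next(w),\mathrm{false})$ and set $next(w):=\bot$, $ear(w):=(w\curvearrowright u)$; if not, add $(w\curvearrowright u)$ to $\alpha(w)$. 3. Otherwise, if $e\neq e_0$, add $(u\curvearrowright w)$ to $Inc(w)$. Finally, for each $(u\curvearrowright w)\in Inc(w)$ call Absorb-subpath$(w,u)$. *Gen-aux-edges$(w,u,Null)$* ($u$ and $Null$ are passed by reference). Let $x:=u$.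 If $deg(u)=1$: $Null:=\mathrm{true}$, $deg(w):=deg(w)-1$. Otherwise, if $next(u)=\bot$: let $(\ddot u\curvearrowright d)=ear(u)$; if $w\ne d$ set $ear(u):=(w\curvearrowright d)$; if $u\neq\ddot u$ add $(u,\ddot u)$ to $\alpha(u)$; $Null:=\mathrm{true}$. Otherwise: let $u_1:=next(u)$, $\ddot u:=parent(u_1)$; set $parent(u_1):=w$; if $u\ne\ddot u$ add $(u,\ddot u)$ to $\alpha(u)$; set $u:=u_1$. In all cases, output $\alpha(x)$ at the end. *Absorb-ear$(w,u,Null)$*. If $Null$, do nothing. Otherwise, if $u=\bot$, add $ear(w)$ to $\alpha(w)$. Otherwise set $x:=u$; repeat $\alpha(w):=\alpha(w)\cup\alpha(x)\cup\{(parent(x),x)\}$, $deg(w):=deg(w)+deg(x)-2$, $x:=next(x)$ until $x=\bot$; then add $ear(u)$ to $\alpha(w)$. *Absorb-subpath$(w,u)$*. Set $deg(w):=deg(w)-2$ and $x:=next(w)$. While $x\ne\bot$ and $u$ is a descendant of $x$: $\alpha(w):=\alpha(w)\cup\alpha(x)\cup\{(parent(x),x)\}$, $deg(w):=deg(w)+deg(x)-2$,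 $x:=next(x)$. Then set $next(w):=x$. -/

import Mathlib

set_option linter.constructorNameAsVariable false

namespace Aux3ecc

/-! ### A random access machine with a step count

Memory consists of finitely many arrays of words, each indexed by words; a word is a natural
number (differences are truncated at `0`).  Programs are built from assignments, memory writes,
writes on an output tape, sequencing, tests, loops and calls of recursive procedures with their own
local variables.  There is no built-in data structure: linked lists are laid out in the arrays by
the program itself.  -/

/-- The arrays of the machine.  `adjHead`, `adjVertex`, `adjEdge`, `adjLink` hold the input
adjacency lists.  The ear of `w` is the back-edge from `earS[w]` to `earT[w]`, and `earT[w] = 0`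
stands for the infinite ear.  `alphaHead[w]`, `alphaTail[w]` are the first and the last cell of
the linked list of the edges in `α(w)`, whose cells are described by `cellA`, `cellB` (the two ends
of an edge) and `cellLink`.  `incHead[w]` is the first cell of the linked list `Inc(w)`,
whose cells are described by `incVertex` and `incLink`.  In all lists, `0` is the null
pointer.  `cnt` and `free` are used at index `0` only: the depth-first number counter and the next
unused cell. -/
inductive Arr
  | adjHead | adjVertex | adjEdge | adjLink
  | dfs | deg | nd | parent | next | earS | earT
  | alphaHead | alphaTail | cellA | cellB | cellLink
  | incHead | incVertex | incLink
  | cnt | free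
  deriving DecidableEq

/-- Names of local variables. -/
inductive Var
  | n | r | i | w | v | e | u | null | c | x | y | s | d
  deriving DecidableEq

/-- Names of procedures. -/
inductive Proc
  | constructAuxSubgraph | genAuxEdges | absorbEar | absorbSubpath | output
  deriving DecidableEq

/-- Arithmetic expressions; `get a i` reads entry `i` of the array `a`. -/
inductive Expr
  | lit (k : ℕ)
  | var (x : Var)
  | get (a : Arr) (i : Expr)
  | add (p q : Expr)
  | sub (p q : Expr)

/-- Tests. -/
inductive Cond
  | eq (p q : Expr)
  | lt (p q : Expr)
  | not (b : Cond)
  | and (b b' : Cond)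
  | or (b b' : Cond)

/-- Commands.  `call p args outs` runs the body of `p` in a new frame of local variables in which
every `(x, e) ∈ args` sets the parameter `x` to the value of `e` in the frame of the caller; when
the body is finished, every `(x, y) ∈ outs` copies the final value of the local variable `y`
of the callee into the variable `x` of the caller (call by reference). -/
inductive Cmd
  | skip
  | assign (x : Var) (e : Expr)
  | set (a : Arr) (i e : Expr)
  | emit (e : Expr)
  | seq (p q : Cmd)
  | ite (b : Cond) (p q : Cmd)
  | while (b : Cond) (p : Cmd)
  | call (p : Proc) (args : List (Var × Expr)) (outs : List (Var × Var))

/-- A machine state: current local variables, memory, and output tape (last word first). -/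
@[ext] structure State where
  var : Var → ℕ
  mem : Arr → ℕ → ℕ
  out : List ℕ

/-- The value of an expression. -/
def Expr.eval (σ : State) : Expr → ℕ
  | .lit k => k
  | .var x => σ.var x
  | .get a i => σ.mem a (i.eval σ)
  | .add p q => p.eval σ + q.eval σ
  | .sub p q => p.eval σ - q.eval σ

/-- The time to evaluate an expression: one step for each constant, variable, memory read and
arithmetic operation. -/
def Expr.cost : Expr → ℕ
  | .lit _ => 1
  | .var _ => 1
  | .get _ i => i.cost + 1
  | .add p q => p.cost + q.cost + 1
  | .sub p q => p.cost + q.cost + 1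

/-- The value of a test. -/
def Cond.eval (σ : State) : Cond → Bool
  | .eq p q => p.eval σ == q.eval σ
  | .lt p q => decide (p.eval σ < q.eval σ)
  | .not b => !(b.eval σ)
  | .and b b' => b.eval σ && b'.eval σ
  | .or b b' => b.eval σ || b'.eval σ

/-- The time to evaluate a test: one step for each operation. -/
def Cond.cost : Cond → ℕ
  | .eq p q => p.cost + q.cost + 1
  | .lt p q => p.cost + q.cost + 1
  | .not b => b.cost + 1
  | .and b b' => b.cost + b'.cost + 1
  | .or b b' => b.cost + b'.cost + 1

/-- The state after setting the local variable `x` to `k`. -/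
def State.setVar (σ : State) (x : Var) (k : ℕ) : State :=
  { σ with var := Function.update σ.var x k }

/-- The state after writing `k` into entry `i` of the array `a`. -/
def State.setMem (σ : State) (a : Arr) (i k : ℕ) : State :=
  { σ with mem := Function.update σ.mem a (Function.update (σ.mem a) i k) }

/-- The new frame of a called procedure; variables that are not parameters start with `0`. -/
def newFrame (σ : State) : List (Var × Expr) → Var → ℕ
  | [] => fun _ => 0
  | (x, e) :: l => Function.update (newFrame σ l) x (e.eval σ)

/-- The frame of the caller after the return of a procedure whose final frame is `ρ'`. -/
def copyBack (ρ ρ' : Var → ℕ) : List (Var × Var) → Var → ℕ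
  | [] => ρ
  | (x, y) :: l => Function.update (copyBack ρ ρ' l) x (ρ' y)

/-- The time to pass the arguments of a call. -/
def argsCost (args : List (Var × Expr)) : ℕ := (args.map fun a => a.2.cost + 1).sum

/-- `Exec body p σ τ t`: started in state `σ`, the command `p` terminates in state `τ` after
exactly `t` steps; `body` assigns to every procedure name its body. -/
inductive Exec (body : Proc → Cmd) : Cmd → State → State → ℕ → Prop
  | skip (σ) : Exec body .skip σ σ 1
  | assign (x e σ) : Exec body (.assign x e) σ (σ.setVar x (e.eval σ)) (e.cost + 1)
  | set (a i e σ) :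
      Exec body (.set a i e) σ (σ.setMem a (i.eval σ) (e.eval σ)) (i.cost + e.cost + 1)
  | emit (e σ) : Exec body (.emit e) σ { σ with out := e.eval σ :: σ.out } (e.cost + 1)
  | seq {p q σ σ₁ σ₂ t₁ t₂} : Exec body p σ σ₁ t₁ → Exec body q σ₁ σ₂ t₂ →
      Exec body (.seq p q) σ σ₂ (t₁ + t₂)
  | iteTrue {b p q σ τ t} : b.eval σ = true → Exec body p σ τ t →
      Exec body (.ite b p q) σ τ (b.cost + t + 1)
  | iteFalse {b p q σ τ t} : b.eval σ = false → Exec body q σ τ t →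
      Exec body (.ite b p q) σ τ (b.cost + t + 1)
  | whileFalse {b p σ} : b.eval σ = false → Exec body (.while b p) σ σ (b.cost + 1)
  | whileTrue {b p σ σ₁ σ₂ t₁ t₂} : b.eval σ = true → Exec body p σ σ₁ t₁ →
      Exec body (.while b p) σ₁ σ₂ t₂ →
      Exec body (.while b p) σ σ₂ (b.cost + t₁ + t₂ + 1)
  | call {p args outs σ τ t} : Exec body (body p) { σ with var := newFrame σ args } τ t →
      Exec body (.call p args outs) σ { τ with var := copyBack σ.var τ.var outs }
        (argsCost args + t + outs.length + 1)

/-- The machine is deterministic: the final state and the number of steps are unique. -/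
theorem Exec.det {body : Proc → Cmd} {p : Cmd} {σ τ τ' : State} {t t' : ℕ}
    (h : Exec body p σ τ t) (h' : Exec body p σ τ' t') : τ = τ' ∧ t = t' := by
  induction h generalizing τ' t' with
  | skip | assign | set | emit => cases h'; exact ⟨rfl, rfl⟩
  | seq _ _ ih₁ ih₂ =>
    cases h' with
    | seq k₁ k₂ =>
      obtain ⟨rfl, rfl⟩ := ih₁ k₁
      obtain ⟨rfl, rfl⟩ := ih₂ k₂
      exact ⟨rfl, rfl⟩
  | iteTrue hb _ ih =>
    cases h' with
    | iteTrue _ k => obtain ⟨rfl, rfl⟩ := ih k; exact ⟨rfl, rfl⟩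
    | iteFalse hb' _ => simp [hb] at hb'
  | iteFalse hb _ ih =>
    cases h' with
    | iteFalse _ k => obtain ⟨rfl, rfl⟩ := ih k; exact ⟨rfl, rfl⟩
    | iteTrue hb' _ => simp [hb] at hb'
  | whileFalse hb =>
    cases h' with
    | whileFalse _ => exact ⟨rfl, rfl⟩
    | whileTrue hb' _ _ => simp [hb] at hb'
  | whileTrue hb _ _ ih₁ ih₂ =>
    cases h' with
    | whileFalse hb' => simp [hb] at hb'
    | whileTrue _ k₁ k₂ =>
      obtain ⟨rfl, rfl⟩ := ih₁ k₁
      obtain ⟨rfl, rfl⟩ := ih₂ k₂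
      exact ⟨rfl, rfl⟩
  | call _ ih =>
    cases h' with
    | call k => obtain ⟨rfl, rfl⟩ := ih k; exact ⟨rfl, rfl⟩

/-! ### The algorithm -/

instance : Coe Var Expr := ⟨Expr.var⟩
instance (k : ℕ) : OfNat Expr k := ⟨Expr.lit k⟩
instance : Add Expr := ⟨Expr.add⟩
instance : Sub Expr := ⟨Expr.sub⟩

local infix:50 " ≐ " => Cond.eq
local infix:50 " ≺ " => Cond.lt
local infixr:35 " && " => Cond.and
local infixr:30 " || " => Cond.or
local infixr:20 " ;; " => Cmd.seq
local infix:25 " ::= " => Cmd.assign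

open Var Arr Cmd
open Aux3ecc.Expr

/-- `p ≠ q`. -/
def neq (p q : Expr) : Cond := .not (p ≐ q)

/-- `if b then p`. -/
def when (b : Cond) (p : Cmd) : Cmd := ite b p skip

/-- `repeat p until b`. -/
def repeatUntil (p : Cmd) (b : Cond) : Cmd := p ;; Cmd.while (.not b) p

/-- Add the edge `(a, b)` to `α(w)`: a new cell is put in front of the list. -/
def addEdge (w a b : Expr) : Cmd :=
  set cellA (get free 0) a ;;
  set cellB (get free 0) b ;;
  set cellLink (get free 0) (get alphaHead w) ;;
  when (get alphaHead w ≐ 0) (set alphaTail w (get free 0)) ;;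
  set alphaHead w (get free 0) ;;
  set free 0 (get free 0 + 1)

/-- `α(w) := α(w) ∪ α(x)`: the list of `x` is linked to the end of the list of `w`. -/
def uniteAlpha (w x : Expr) : Cmd :=
  when (neq (get alphaHead x) 0)
    (ite (get alphaHead w ≐ 0)
      (set alphaHead w (get alphaHead x))
      (set cellLink (get alphaTail w) (get alphaHead x)) ;;
    set alphaTail w (get alphaTail x))

/-- `α(w) := α(w) ∪ {ear(u)}`, where the infinite ear is no edge. -/
def addEar (w u : Expr) : Cmd :=
  when (neq (get earT u) 0) (addEdge w (get earS u) (get earT u))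

/-- `Inc(w) := Inc(w) ∪ {(u ↷ w)}`. -/
def addInc (w u : Expr) : Cmd :=
  set incVertex (get free 0) u ;;
  set incLink (get free 0) (get incHead w) ;;
  set incHead w (get free 0) ;;
  set free 0 (get free 0 + 1)

/-- `b` is a descendant of `a` (possibly `a` itself). -/
def isDescendant (b a : Expr) : Cond :=
  .not (get dfs b ≺ get dfs a) && get dfs b ≺ get dfs a + get nd a

/-- The back-edge `(p ↷ q)` is lexicographically smaller than the back-edge `(x ↷ y)`, as compared
at the vertex `w`; a head `0` stands for the infinite ear of `w`, which is larger than
`(x ↷ y)` if `y` is a proper ancestor of `w` and smaller otherwise. -/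
def lexLt (w p q x y : Expr) : Cond :=
  (neq q 0 && neq y 0 &&
    (get dfs q ≺ get dfs y ||
      (q ≐ y && get dfs p ≺ get dfs x && .not (isDescendant x p)) ||
      (q ≐ y && neq p x && isDescendant p x))) ||
  (neq q 0 && y ≐ 0 && get dfs q ≺ get dfs w) ||
  (q ≐ 0 && neq y 0 && .not (get dfs y ≺ get dfs w))

/-- Procedure `output`, with parameter `u`: write the edges of `α(u)`, followed by a `0`, on the
output tape. -/
def outputBody : Cmd :=
  c ::= get alphaHead u ;;
  Cmd.while (neq c 0)
    (emit (get cellA c) ;;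
    emit (get cellB c) ;;
    c ::= get cellLink c) ;;
  emit 0

/-- Procedure `Absorb-ear(w, u, Null)`. -/
def absorbEarBody : Cmd :=
  when (null ≐ 0)
    (ite (u ≐ 0)
      (addEar w w)
      (x ::= u ;;
      repeatUntil
        (uniteAlpha w x ;;
        addEdge w (get parent x) x ;;
        set deg w (get deg w + get deg x - 2) ;;
        x ::= get next x)
        (x ≐ 0) ;;
      addEar w u))

/-- Procedure `Absorb-subpath(w, u)`. -/
def absorbSubpathBody : Cmd :=
  set deg w (get deg w - 2) ;;
  x ::= get next w ;;
  Cmd.while (neq x 0 && isDescendant u x)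
    (uniteAlpha w x ;;
    addEdge w (get parent x) x ;;
    set deg w (get deg w + get deg x - 2) ;;
    x ::= get next x) ;;
  set next w x

/-- Procedure `Gen-aux-edges(w, u, Null)`, where `u` and `Null` are passed by reference.  The
ejected vertex is kept in `x`; a bridge `(w, u)` is removed from the graph. -/
def genAuxEdgesBody : Cmd :=
  x ::= u ;;
  ite (get deg u ≐ 1)
    (null ::= 1 ;;
    set deg w (get deg w - 1))
    (ite (get next u ≐ 0)
      (s ::= get earS u ;;
      d ::= get earT u ;;
      when (neq w d) (set earS u w ;; set earT u d) ;;
      when (neq u s) (addEdge u u s) ;;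
      null ::= 1)
      (y ::= get next u ;;
      s ::= get parent y ;;
      set parent y w ;;
      when (neq u s) (addEdge u u s) ;;
      u ::= y)) ;;
  call .output [(u, x)] []

/-- Processing of an adjacency list entry of `w` with an unvisited neighbour `u`, which the edge
with the number `adjEdge[c]` joins to `w`. -/
def processChild : Cmd :=
  null ::= 0 ;;
  call .constructAuxSubgraph [(w, u), (v, w), (e, get adjEdge c)] [] ;;
  set nd w (get nd w + get nd u) ;;
  when (get deg u ≺ 3)
    (call .genAuxEdges [(w, w), (u, u), (null, null)] [(u, u), (null, null)]) ;;
  ite (.not (lexLt w (get earS u) (get earT u) (get earS w) (get earT w)))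
    (call .absorbEar [(w, w), (u, u), (null, null)] [] ;;
    when (null ≐ 1 && neq (get earT u) 0 && get dfs (get earT u) ≺ get dfs w) (addEar w u))
    (call .absorbEar [(w, w), (u, get next w), (null, 0)] [] ;;
    ite (null ≐ 1) (set next w 0) (set next w u) ;;
    set earS w (get earS u) ;;
    set earT w (get earT u))

/-- Processing of an outgoing back-edge `(w ↷ u)`. -/
def processOutgoing : Cmd :=
  ite (lexLt w w u (get earS w) (get earT w))
    (call .absorbEar [(w, w), (u, get next w), (null, 0)] [] ;;
    set next w 0 ;;
    set earS w w ;;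
    set earT w u)
    (addEdge w w u)

/-- Procedure `construct-aux-subgraph(w, v)`; `e` is the number of the tree edge `(v, w)`, by which
it is told apart from the edges parallel to it. -/
def constructAuxSubgraphBody : Cmd :=
  set dfs w (get cnt 0) ;;
  set cnt 0 (get cnt 0 + 1) ;;
  set parent w v ;;
  set next w 0 ;;
  set earS w 0 ;;
  set earT w 0 ;;
  c ::= get adjHead w ;;
  Cmd.while (neq c 0)
    (u ::= get adjVertex c ;;
    set deg w (get deg w + 1) ;;
    ite (get dfs u ≐ 0)
      processChild
      (ite (get dfs u ≺ get dfs w && neq (get adjEdge c) e)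
        processOutgoing
        (when (neq (get adjEdge c) e) (addInc w u))) ;;
    c ::= get adjLink c) ;;
  c ::= get incHead w ;;
  Cmd.while (neq c 0)
    (call .absorbSubpath [(w, w), (u, get incVertex c)] [] ;;
    c ::= get incLink c)

/-- The procedures of the algorithm. -/
def procedures : Proc → Cmd
  | .constructAuxSubgraph => constructAuxSubgraphBody
  | .genAuxEdges => genAuxEdgesBody
  | .absorbEar => absorbEarBody
  | .absorbSubpath => absorbSubpathBody
  | .output => outputBody

/-- The main program of Algorithm `Auxiliary-3ecc-subgraphs`; its inputs are the number `n` of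
vertices, the vertex `r` where the search begins, and the adjacency lists. -/
def auxiliary3eccSubgraphs : Cmd :=
  i ::= 1 ;;
  Cmd.while (i ≺ n + 1)
    (set dfs i 0 ;;
    set deg i 0 ;;
    set nd i 1 ;;
    set parent i 0 ;;
    set alphaHead i 0 ;;
    set incHead i 0 ;;
    i ::= i + 1) ;;
  set free 0 1 ;;
  set cnt 0 1 ;;
  call .constructAuxSubgraph [(w, r), (v, 0), (e, 0)] [] ;;
  call .output [(u, r)] []

/-! ### The input -/

open scoped Graph

/-- A multigraph is connected if it has a vertex and any two vertices are joined by a path. -/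
def Connected (G : Graph ℕ ℕ) : Prop :=
  V(G).Nonempty ∧ ∀ a ∈ V(G), ∀ b ∈ V(G), Relation.ReflTransGen G.Adj a b

/-- `cs` is the sequence of the cells of the null-terminated linked list that starts at a given
cell. -/
inductive LinkedCells (link : ℕ → ℕ) : ℕ → List ℕ → Prop
  | nil : LinkedCells link 0 []
  | cons {a : ℕ} {cs : List ℕ} : a ≠ 0 → LinkedCells link (link a) cs →
      LinkedCells link a (a :: cs)

/-- The state `σ` holds the input: the vertices and the edges of `G` are numbered from `1` on, and
for every vertex `a` the linked list at `adjHead[a]` is the adjacency list of `a`, in any order: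
it has exactly one entry for each edge incident with `a`, which consists of the number of the edge
and its other end.  Nothing is assumed about the rest of the memory. -/
structure IsInput (G : Graph ℕ ℕ) (root : ℕ) (σ : State) : Prop where
  vertexSet_eq : V(G) = Set.Icc 1 (σ.var .n)
  edgeSet_eq : E(G) = Set.Icc 1 E(G).ncard
  root_eq : σ.var .r = root
  root_mem : root ∈ V(G)
  adjacencyList : ∀ a ∈ V(G), ∃ cs : List ℕ,
    LinkedCells (σ.mem .adjLink) (σ.mem .adjHead a) cs ∧
    (cs.map fun k => (σ.mem .adjEdge k, σ.mem .adjVertex k)).Nodup ∧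
    ∀ f b, (f, b) ∈ cs.map (fun k => (σ.mem .adjEdge k, σ.mem .adjVertex k)) ↔ G.IsLink f a b

end Aux3ecc

namespace Aux3ecc

/-! ### Weakest preconditions -/

/-! The bound is an amortized one, and nothing about 3-edge-connectivity enters it. The values of
`deg`, `nd` and `ear`, the outcome of the lexicographic comparison and of the descendant test are
never analysed: every test that depends on them is followed along both branches. What has to be
known is only that the linked structures are sound, so that every loop ends and every unit of work
has something to be charged to.

The soundness rests on a set `L` of live vertices, those neither absorbed nor ejected so far. The
lists `α(a)`, `a ∈ L`, are null-terminated and pairwise disjoint, with `N` cells in all (`Heap`);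
the lists of dead vertices may contain anything. While `w` is processed, `next(w)` starts a
null-terminated path of live vertices that were discovered since the processing of `w` began
(`Loc`). A recursive call leaves the data of all vertices visited before it untouched (`Ext`), so
the path of `w` survives the call, and the path that the child hands over is disjoint from it,
because its vertices were still unvisited when the call began.

The time is paid by a potential with four parts. An unvisited vertex carries 5000, plus 5000 for
each entry of its adjacency list, released when it is visited (`unvisitedCredit`). A live vertex
carries 200, spent when it leaves `L`, so a long absorption loop is free up to a constant. A cell of
a live list `α(a)` carries 20, spent when it is written on the output tape. A cell of `Inc(w)`
carries 400, spent on one call of `absorbSubpath`. Each elementary step of the search is shown to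
raise time plus potential by at most a constant, which the adjacency entry at hand supplies.

Induction on the number of unvisited vertices shows that a call of `constructAuxSubgraph` does not
raise time plus potential at all (`constructSpec`). The total is therefore at most the initial
potential, up to initialization and final output, hence linear in the number of vertices plus the
total length of the adjacency lists; the latter is at most twice the number of edges
(`sum_length_le`). -/

/-- Started in `σ`, the command `p` terminates, and `Q` holds of the final state and the time. -/
def Run (p : Cmd) (σ : State) (Q : State → ℕ → Prop) : Prop :=
  ∃ τ t, Exec procedures p σ τ t ∧ Q τ t

theorem Run.mono {p : Cmd} {σ : State} {Q Q' : State → ℕ → Prop} (h : Run p σ Q)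
    (hQ : ∀ τ t, Q τ t → Q' τ t) : Run p σ Q' := by
  obtain ⟨τ, t, h, hq⟩ := h
  exact ⟨τ, t, h, hQ _ _ hq⟩

theorem run_skip {σ : State} {Q : State → ℕ → Prop} : Run .skip σ Q ↔ Q σ 1 :=
  ⟨by rintro ⟨_, _, ⟨⟩, h⟩; exact h, fun h => ⟨_, _, .skip σ, h⟩⟩

theorem run_assign {x : Var} {e : Expr} {σ : State} {Q : State → ℕ → Prop} :
    Run (.assign x e) σ Q ↔ Q (σ.setVar x (e.eval σ)) (e.cost + 1) :=
  ⟨by rintro ⟨_, _, ⟨⟩, h⟩; exact h, fun h => ⟨_, _, .assign x e σ, h⟩⟩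

theorem run_set {a : Arr} {i e : Expr} {σ : State} {Q : State → ℕ → Prop} :
    Run (.set a i e) σ Q ↔ Q (σ.setMem a (i.eval σ) (e.eval σ)) (i.cost + e.cost + 1) :=
  ⟨by rintro ⟨_, _, ⟨⟩, h⟩; exact h, fun h => ⟨_, _, .set a i e σ, h⟩⟩

theorem run_emit {e : Expr} {σ : State} {Q : State → ℕ → Prop} :
    Run (.emit e) σ Q ↔ Q { σ with out := e.eval σ :: σ.out } (e.cost + 1) :=
  ⟨by rintro ⟨_, _, ⟨⟩, h⟩; exact h, fun h => ⟨_, _, .emit e σ, h⟩⟩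

theorem run_seq {p q : Cmd} {σ : State} {Q : State → ℕ → Prop} :
    Run (.seq p q) σ Q ↔ Run p σ fun τ t => Run q τ fun τ' t' => Q τ' (t + t') := by
  constructor
  · rintro ⟨_, _, ⟨⟩, h⟩
    exact ⟨_, _, ‹_›, _, _, ‹_›, h⟩
  · rintro ⟨_, _, h, _, _, h', hq⟩
    exact ⟨_, _, .seq h h', hq⟩

theorem run_ite {b : Cond} {p q : Cmd} {σ : State} {Q : State → ℕ → Prop} :
    Run (.ite b p q) σ Q ↔
      (b.eval σ = true → Run p σ fun τ t => Q τ (b.cost + t + 1)) ∧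
      (b.eval σ = false → Run q σ fun τ t => Q τ (b.cost + t + 1)) := by
  constructor
  · rintro ⟨_, _, ⟨⟩, h⟩
    · exact ⟨fun _ => ⟨_, _, ‹_›, h⟩, fun h' => by simp_all⟩
    · exact ⟨fun h' => by simp_all, fun _ => ⟨_, _, ‹_›, h⟩⟩
  · rintro ⟨h₁, h₂⟩
    cases hb : b.eval σ
    · obtain ⟨_, _, h, hq⟩ := h₂ hb
      exact ⟨_, _, .iteFalse hb h, hq⟩
    · obtain ⟨_, _, h, hq⟩ := h₁ hb
      exact ⟨_, _, .iteTrue hb h, hq⟩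

theorem run_when {b : Cond} {p : Cmd} {σ : State} {Q : State → ℕ → Prop} :
    Run (when b p) σ Q ↔
      (b.eval σ = true → Run p σ fun τ t => Q τ (b.cost + t + 1)) ∧
      (b.eval σ = false → Q σ (b.cost + 2)) := by
  simp only [when, run_ite, run_skip]

/-- One unfolding of the loop replaces an invariant rule: each loop is later treated by induction,
on the list of cells that it walks through or on a counter. -/
theorem run_while {b : Cond} {p : Cmd} {σ : State} {Q : State → ℕ → Prop} :
    Run (.while b p) σ Q ↔
      (b.eval σ = true → Run p σ fun τ t =>
        Run (.while b p) τ fun τ' t' => Q τ' (b.cost + t + t' + 1)) ∧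
      (b.eval σ = false → Q σ (b.cost + 1)) := by
  constructor
  · rintro ⟨_, _, ⟨⟩, h⟩
    · exact ⟨fun h' => by simp_all, fun _ => h⟩
    · exact ⟨fun _ => ⟨_, _, ‹_›, _, _, ‹_›, h⟩, fun h' => by simp_all⟩
  · rintro ⟨h₁, h₂⟩
    cases hb : b.eval σ
    · exact ⟨_, _, .whileFalse hb, h₂ hb⟩
    · obtain ⟨_, _, h, _, _, h', hq⟩ := h₁ hb
      exact ⟨_, _, .whileTrue hb h h', hq⟩

theorem run_call {p : Proc} {args : List (Var × Expr)} {outs : List (Var × Var)} {σ : State}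
    {Q : State → ℕ → Prop} :
    Run (.call p args outs) σ Q ↔
      Run (procedures p) { σ with var := newFrame σ args } fun τ t =>
        Q { τ with var := copyBack σ.var τ.var outs } (argsCost args + t + outs.length + 1) :=
  ⟨by rintro ⟨_, _, ⟨⟩, h⟩; exact ⟨_, _, ‹_›, h⟩, fun ⟨_, _, h, hq⟩ => ⟨_, _, .call h, hq⟩⟩

@[simp] theorem Expr.eval_ofNat (σ : State) (k : ℕ) :
    Expr.eval σ (no_index (OfNat.ofNat k)) = k := rfl
@[simp] theorem Expr.eval_add' (σ : State) (p q : Expr) :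
    (p + q).eval σ = p.eval σ + q.eval σ := rfl
@[simp] theorem Expr.cost_ofNat (k : ℕ) : Expr.cost (no_index (OfNat.ofNat k)) = 1 := rfl
@[simp] theorem Expr.cost_add' (p q : Expr) : (p + q).cost = p.cost + q.cost + 1 := rfl
@[simp] theorem Expr.cost_sub' (p q : Expr) : (p - q).cost = p.cost + q.cost + 1 := rfl

attribute [simp] Expr.eval Expr.cost Cond.eval Cond.cost State.setVar State.setMem newFrame copyBack
  argsCost neq run_skip run_assign run_set run_emit run_seq run_when run_call

/-! ### Linked lists -/

namespace LinkedCells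

variable {l l' : ℕ → ℕ} {a b : ℕ} {cs ds : List ℕ}

theorem congr (h : LinkedCells l a cs) (hl : ∀ k ∈ cs, l' k = l k) : LinkedCells l' a cs := by
  induction h with
  | nil => exact .nil
  | cons ha _ ih =>
    refine .cons ha ?_
    rw [hl _ (by simp)]
    exact ih fun k hk => hl k (by simp [hk])

theorem zero_iff : LinkedCells l 0 cs ↔ cs = [] :=
  ⟨fun h => by cases h with | nil => rfl | cons h => exact absurd rfl h, fun h => h ▸ .nil⟩

theorem eq_cons (h : LinkedCells l a cs) (ha : a ≠ 0) :
    ∃ ds, cs = a :: ds ∧ LinkedCells l (l a) ds := by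
  cases h with
  | nil => exact absurd rfl ha
  | cons _ h => exact ⟨_, rfl, h⟩

theorem unique (h : LinkedCells l a cs) (h' : LinkedCells l a ds) : cs = ds := by
  induction h generalizing ds with
  | nil => exact (zero_iff.1 h').symm
  | cons ha _ ih =>
    obtain ⟨es, he, h'⟩ := h'.eq_cons ha
    rw [he, ih h']

theorem suffix_of_mem (h : LinkedCells l a cs) (hb : b ∈ cs) :
    ∃ ds, LinkedCells l b ds ∧ ds.length ≤ cs.length := by
  induction h with
  | nil => simp at hb
  | @cons a cs ha h ih =>
    rcases List.mem_cons.1 hb with rfl | hb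
    · exact ⟨_, .cons ha h, le_rfl⟩
    · obtain ⟨ds, hd, hl⟩ := ih hb
      exact ⟨ds, hd, by simp; omega⟩

/-- A cell determines everything that follows it, so a cell met twice would start two lists of
different lengths. -/
theorem nodup (h : LinkedCells l a cs) : cs.Nodup := by
  induction h with
  | nil => simp
  | @cons a cs ha h ih =>
    refine List.nodup_cons.2 ⟨fun hm => ?_, ih⟩
    obtain ⟨ds, hd, hl⟩ := h.suffix_of_mem hm
    have := hd.unique (.cons ha h)
    subst this
    simp at hl

/-- Redirecting the link of the last cell `k` splices the second list behind the first. Since `k`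
occurs only once in the first list and not at all in the second, no other link that matters changes.
-/
theorem append (h : LinkedCells l a cs) (h' : LinkedCells l b ds) (hd : cs.Disjoint ds)
    {k : ℕ} (hk : k ∈ cs.getLast?) :
    LinkedCells (Function.update l k b) a (cs ++ ds) := by
  have hn := h.nodup
  induction h with
  | nil => simp at hk
  | @cons a cs ha h ih =>
    refine .cons ha ?_
    rcases eq_or_ne (l a) 0 with h0 | h0
    · rw [h0, zero_iff] at h
      subst h
      obtain rfl : a = k := by simpa using hk
      simp only [Function.update_self]
      refine h'.congr fun j hj => Function.update_of_ne ?_ _ _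
      rintro rfl
      exact hd (by simp) hj
    · obtain ⟨es, rfl, -⟩ := h.eq_cons h0
      have hk' : k ∈ (l a :: es).getLast? := by simpa using hk
      have hak : a ≠ k := by
        rintro rfl
        exact (List.nodup_cons.1 hn).1 (List.mem_of_getLast? hk')
      rw [Function.update_of_ne hak]
      exact ih (fun j hj => hd (List.mem_cons_of_mem _ hj)) hk' (List.nodup_cons.1 hn).2

end LinkedCells

/-! ### The lists of edges -/

/-- `A a` is the list of the cells of `α(a)`, for all `a ∈ L`, and these lists are disjoint. -/
structure AlphaLists (m : Arr → ℕ → ℕ) (L : Finset ℕ) (A : ℕ → List ℕ) : Prop where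
  linked : ∀ a ∈ L, LinkedCells (m .cellLink) (m .alphaHead a) (A a)
  tail : ∀ a ∈ L, ∀ k ∈ (A a).getLast?, m .alphaTail a = k
  disjoint : ∀ a ∈ L, ∀ b ∈ L, a ≠ b → (A a).Disjoint (A b)
  lt_free : ∀ a ∈ L, ∀ k ∈ A a, k < m .free 0
  free_pos : 0 < m .free 0

/-- The sets `α(a)`, `a ∈ L`, are stored in disjoint lists with `N` cells in all. -/
def Heap (m : Arr → ℕ → ℕ) (L : Finset ℕ) (N : ℕ) : Prop :=
  ∃ A, AlphaLists m L A ∧ ∑ a ∈ L, (A a).length = N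

theorem Heap.congr {m m' : Arr → ℕ → ℕ} {L : Finset ℕ} {N : ℕ} (h : Heap m L N)
    (h₁ : m' .cellLink = m .cellLink) (h₂ : m' .alphaHead = m .alphaHead)
    (h₃ : m' .alphaTail = m .alphaTail) (h₄ : m .free 0 ≤ m' .free 0) : Heap m' L N := by
  obtain ⟨A, ⟨ha, hb, hc, hd, he⟩, hN⟩ := h
  refine ⟨A, ⟨?_, ?_, hc, fun a ha k hk => (hd a ha k hk).trans_le h₄, he.trans_le h₄⟩, hN⟩
  · rwa [h₁, h₂]
  · rwa [h₃]

/-- Dropping a vertex from the live set releases the cells of its list; the credit of these cells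
pays for writing them out. -/
theorem Heap.erase {m : Arr → ℕ → ℕ} {L : Finset ℕ} {N a : ℕ} (h : Heap m L N) (ha : a ∈ L) :
    ∃ cs N', LinkedCells (m .cellLink) (m .alphaHead a) cs ∧ cs.length + N' = N ∧
      Heap m (L.erase a) N' := by
  obtain ⟨A, h, rfl⟩ := h
  refine ⟨A a, ∑ b ∈ L.erase a, (A b).length, h.linked a ha,
    Finset.add_sum_erase L (fun b => (A b).length) ha, A, ?_, rfl⟩
  have hL : ∀ b ∈ L.erase a, b ∈ L := fun b hb => Finset.mem_of_mem_erase hb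
  exact ⟨fun b hb => h.linked b (hL b hb), fun b hb => h.tail b (hL b hb),
    fun b hb c hc => h.disjoint b (hL b hb) c (hL c hc), fun b hb => h.lt_free b (hL b hb),
    h.free_pos⟩

/-- The new cell has address `free`, above all cells in use, so no existing list is disturbed. The
tail pointer is correct for nonempty lists only, which is why it is set just when the list was
empty. -/
theorem Heap.push {m m' : Arr → ℕ → ℕ} {L : Finset ℕ} {N w : ℕ} (h : Heap m L N) (hw : w ∈ L)
    (h₁ : m' .cellLink = Function.update (m .cellLink) (m .free 0) (m .alphaHead w))
    (h₂ : m' .alphaHead = Function.update (m .alphaHead) w (m .free 0))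
    (h₃ : m' .alphaTail = if m .alphaHead w = 0 then
      Function.update (m .alphaTail) w (m .free 0) else m .alphaTail)
    (h₄ : m' .free 0 = m .free 0 + 1) : Heap m' L (N + 1) := by
  obtain ⟨A, h, rfl⟩ := h
  have old : ∀ a ∈ L, LinkedCells (m' .cellLink) (m .alphaHead a) (A a) := fun a ha =>
    (h.linked a ha).congr fun k hk => by
      rw [h₁, Function.update_of_ne (h.lt_free a ha k hk).ne]
  refine ⟨Function.update A w (m .free 0 :: A w), ⟨?_, ?_, ?_, ?_, by omega⟩, ?_⟩
  · intro a ha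
    rw [h₂]
    rcases eq_or_ne a w with rfl | haw
    · simp only [Function.update_self]
      refine .cons h.free_pos.ne' ?_
      have := old a ha
      rwa [h₁, Function.update_self, ← h₁]
    · simpa [haw] using old a ha
  · intro a ha k hk
    rw [h₃]
    rcases eq_or_ne a w with rfl | haw
    · rw [Function.update_self] at hk
      have hl := h.linked a ha
      split_ifs with h0
      · rw [h0, LinkedCells.zero_iff] at hl
        simpa [hl] using hk
      · obtain ⟨ds, hd, -⟩ := hl.eq_cons h0
        refine h.tail a ha k ?_
        rw [hd] at hk ⊢
        simpa using hk
    · rw [Function.update_of_ne haw] at hk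
      have := h.tail a ha k hk
      split_ifs <;> simpa [haw] using this
  · intro a ha b hb hab
    rcases eq_or_ne a w with rfl | haw
    · rw [Function.update_self, Function.update_of_ne hab.symm, List.disjoint_cons_left]
      exact ⟨fun hm => (h.lt_free b hb _ hm).false, h.disjoint a ha b hb hab⟩
    · rcases eq_or_ne b w with rfl | hbw
      · rw [Function.update_self, Function.update_of_ne hab, List.disjoint_cons_right]
        exact ⟨fun hm => (h.lt_free a ha _ hm).false, h.disjoint a ha b hb hab⟩
      · simpa [haw, hbw] using h.disjoint a ha b hb hab
  · intro a ha k hk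
    rcases eq_or_ne a w with rfl | haw
    · rw [Function.update_self, List.mem_cons] at hk
      rcases hk with rfl | hk
      · omega
      · have := h.lt_free a ha k hk
        omega
    · rw [Function.update_of_ne haw] at hk
      have := h.lt_free a ha k hk
      omega
  · rw [← Finset.add_sum_erase L _ hw, ← Finset.add_sum_erase L (fun a => (A a).length) hw,
      Finset.sum_congr rfl fun a ha => by rw [Function.update_of_ne (Finset.ne_of_mem_erase ha)]]
    simp
    omega

/-- Disjointness of the lists ensures that overwriting the link of the last cell of `w` affects no
third list. The cells of `x` now belong to `w`, so `N` is unchanged while `x` leaves the live set.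
-/
theorem Heap.unite {m m' : Arr → ℕ → ℕ} {L : Finset ℕ} {N w x : ℕ} (h : Heap m L N) (hw : w ∈ L)
    (hx : x ∈ L) (hwx : w ≠ x) (hx0 : m .alphaHead x ≠ 0)
    (h₁ : m' .cellLink = if m .alphaHead w = 0 then m .cellLink else
      Function.update (m .cellLink) (m .alphaTail w) (m .alphaHead x))
    (h₂ : m' .alphaHead = if m .alphaHead w = 0 then
      Function.update (m .alphaHead) w (m .alphaHead x) else m .alphaHead)
    (h₃ : m' .alphaTail = Function.update (m .alphaTail) w (m .alphaTail x))
    (h₄ : m' .free 0 = m .free 0) : Heap m' (L.erase x) N := by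
  obtain ⟨A, h, rfl⟩ := h
  have hL : ∀ b ∈ L.erase x, b ∈ L := fun b hb => Finset.mem_of_mem_erase hb
  have hw' : w ∈ L.erase x := Finset.mem_erase.2 ⟨hwx, hw⟩
  -- A nonempty list has a last cell, and only then is the stored tail pointer meaningful.
  have htail : m .alphaHead w ≠ 0 → m .alphaTail w ∈ (A w).getLast? := fun h0 => by
    obtain ⟨ds, hd, -⟩ := (h.linked w hw).eq_cons h0
    obtain ⟨k, hk⟩ : ∃ k, (A w).getLast? = some k := by simp [hd, List.getLast?_cons]
    rw [h.tail w hw k hk]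
    exact hk
  refine ⟨Function.update A w (A w ++ A x), ⟨?_, ?_, ?_, ?_, h₄ ▸ h.free_pos⟩, ?_⟩
  · intro a ha
    have hla := h.linked a (hL a ha)
    rw [h₁, h₂]
    rcases eq_or_ne a w with rfl | haw
    · rw [Function.update_self]
      split_ifs with h0
      · rw [h0, LinkedCells.zero_iff] at hla
        simpa [hla] using h.linked x hx
      · exact hla.append (h.linked x hx) (h.disjoint a hw x hx hwx) (htail h0)
    · rw [Function.update_of_ne haw]
      split_ifs with h0
      · simpa [haw] using hla
      · refine hla.congr fun k hk => Function.update_of_ne ?_ _ _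
        rintro rfl
        exact h.disjoint a (hL a ha) w hw haw hk (List.mem_of_getLast? (htail h0))
  · intro a ha k hk
    rw [h₃]
    rcases eq_or_ne a w with rfl | haw
    · rw [Function.update_self] at hk ⊢
      obtain ⟨ds, hd, -⟩ := (h.linked x hx).eq_cons hx0
      refine h.tail x hx k ?_
      rw [hd] at hk ⊢
      simpa [List.getLast?_append, List.getLast?_cons] using hk
    · rw [Function.update_of_ne haw] at hk ⊢
      exact h.tail a (hL a ha) k hk
  · intro a ha b hb hab
    have hax := Finset.ne_of_mem_erase ha
    have hbx := Finset.ne_of_mem_erase hb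
    rcases eq_or_ne a w with rfl | haw
    · rw [Function.update_self, Function.update_of_ne hab.symm, List.disjoint_append_left]
      exact ⟨h.disjoint a hw b (hL b hb) hab, h.disjoint x hx b (hL b hb) hbx.symm⟩
    · rcases eq_or_ne b w with rfl | hbw
      · rw [Function.update_self, Function.update_of_ne hab, List.disjoint_append_right]
        exact ⟨h.disjoint a (hL a ha) b hw hab, h.disjoint a (hL a ha) x hx hax⟩
      · simpa [haw, hbw] using h.disjoint a (hL a ha) b (hL b hb) hab
  · intro a ha k hk
    rw [h₄]
    rcases eq_or_ne a w with rfl | haw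
    · rw [Function.update_self, List.mem_append] at hk
      exact hk.elim (h.lt_free a hw k) (h.lt_free x hx k)
    · rw [Function.update_of_ne haw] at hk
      exact h.lt_free a (hL a ha) k hk
  · rw [← Finset.add_sum_erase _ _ hw', ← Finset.add_sum_erase L (fun a => (A a).length) hx,
      ← Finset.add_sum_erase _ (fun a => (A a).length) hw',
      Finset.sum_congr rfl fun a ha => by rw [Function.update_of_ne (Finset.ne_of_mem_erase ha)]]
    simp
    omega

/-! ### The procedures on sets of edges and on paths -/

/-- `m'` agrees with `m` on the arrays that direct the search, except for `next`. -/
structure Agree (m m' : Arr → ℕ → ℕ) : Prop where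
  dfs : m' .dfs = m .dfs
  incHead : m' .incHead = m .incHead
  incLink : m' .incLink = m .incLink
  cnt : m' .cnt = m .cnt
  adjHead : m' .adjHead = m .adjHead
  adjVertex : m' .adjVertex = m .adjVertex
  adjLink : m' .adjLink = m .adjLink
  free : m .free 0 ≤ m' .free 0

theorem Agree.refl (m : Arr → ℕ → ℕ) : Agree m m := by constructor <;> rfl

theorem Agree.trans {m m' m'' : Arr → ℕ → ℕ} (h : Agree m m') (h' : Agree m' m'') :
    Agree m m'' :=
  ⟨h'.dfs.trans h.dfs, h'.incHead.trans h.incHead, h'.incLink.trans h.incLink,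
    h'.cnt.trans h.cnt, h'.adjHead.trans h.adjHead, h'.adjVertex.trans h.adjVertex,
    h'.adjLink.trans h.adjLink, h.free.trans h'.free⟩

/-- The time set aside for the vertices in `L` and for `N` cells. -/
def credit (L : Finset ℕ) (N : ℕ) : ℕ := 200 * L.card + 20 * N

theorem credit_erase {L : Finset ℕ} {a : ℕ} (h : a ∈ L) (N : ℕ) :
    credit (L.erase a) N + 200 = credit L N := by
  have := Finset.card_erase_add_one h
  unfold credit
  omega

theorem run_addEdge {x : Var} {a b : Expr} {σ : State} {L : Finset ℕ} {N : ℕ}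
    (h : Heap σ.mem L N) (hx : σ.var x ∈ L) :
    Run (addEdge (.var x) a b) σ fun τ t => τ.var = σ.var ∧ Agree σ.mem τ.mem ∧
      τ.mem .next = σ.mem .next ∧ Heap τ.mem L (N + 1) ∧ t ≤ a.cost + b.cost + 40 := by
  simp only [addEdge, run_seq, run_set, run_when]
  constructor <;> intro h0 <;> simp at h0 <;> simp <;>
    refine ⟨by constructor <;> simp, h.push hx ?_ ?_ ?_ ?_, by omega⟩ <;> simp [h0]

theorem run_uniteAlpha {x y : Var} {σ : State} {L : Finset ℕ} {N : ℕ}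
    (h : Heap σ.mem L N) (hx : σ.var x ∈ L) (hy : σ.var y ∈ L) (hxy : σ.var x ≠ σ.var y) :
    Run (uniteAlpha (.var x) (.var y)) σ fun τ t => τ.var = σ.var ∧ Agree σ.mem τ.mem ∧
      τ.mem .next = σ.mem .next ∧
      (∃ N' ≤ N, Heap τ.mem (L.erase (σ.var y)) N') ∧ t ≤ 40 := by
  simp only [uniteAlpha, run_when, run_seq, run_ite]
  constructor
  · intro h1
    simp at h1
    constructor <;> intro h0 <;> simp at h0 <;> simp <;>
      refine ⟨by constructor <;> simp, N, le_rfl, h.unite hx hy hxy h1 ?_ ?_ ?_ ?_⟩ <;>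
      simp [h0]
  · intro h1
    obtain ⟨cs, N', -, hN, h'⟩ := h.erase hy
    simp
    exact ⟨.refl _, N', by omega, h'⟩

theorem run_addEar {x y : Var} {σ : State} {L : Finset ℕ} {N : ℕ}
    (h : Heap σ.mem L N) (hx : σ.var x ∈ L) :
    Run (addEar (.var x) (.var y)) σ fun τ t => τ.var = σ.var ∧ Agree σ.mem τ.mem ∧
      τ.mem .next = σ.mem .next ∧ ∃ N', Heap τ.mem L N' ∧ t + 20 * N' ≤ 20 * N + 100 := by
  simp only [addEar, run_when]
  constructor
  · intro _
    refine (run_addEdge h hx).mono fun τ t ⟨hv, ha, hn, hh, ht⟩ => ⟨hv, ha, hn, _, hh, ?_⟩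
    simp at ht ⊢
    omega
  · intro _
    refine ⟨trivial, .refl _, trivial, N, h, ?_⟩
    simp
    omega

theorem run_output {x : Var} {σ : State} {L : Finset ℕ} {N : ℕ}
    (h : Heap σ.mem L N) (hx : σ.var x ∈ L) :
    Run (.call .output [(.u, .var x)] []) σ fun τ t => τ.var = σ.var ∧ τ.mem = σ.mem ∧
      ∃ N', Heap τ.mem (L.erase (σ.var x)) N' ∧ t + 20 * N' ≤ 20 * N + 20 := by
  obtain ⟨cs, N', hl, hN, h'⟩ := h.erase hx
  have loop : ∀ cs (τ : State), LinkedCells (τ.mem .cellLink) (τ.var .c) cs →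
      Run (.while (neq (.var .c) 0) (.seq (.emit (.get .cellA (.var .c)))
        (.seq (.emit (.get .cellB (.var .c)))
          (.assign .c (.get .cellLink (.var .c)))))) τ fun τ' t =>
        τ'.mem = τ.mem ∧ t ≤ 20 * cs.length + 5 := by
    intro cs
    induction cs with
    | nil =>
      intro τ hl
      rw [run_while]
      cases hl' : τ.var .c with
      | zero => simp [hl']
      | succ k =>
        obtain ⟨_, h, -⟩ := hl.eq_cons (by omega)
        simp at h
    | cons a cs ih =>
      intro τ hl
      rw [run_while]
      generalize hc : τ.var .c = c at hl
      cases hl with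
      | cons ha hl =>
        subst hc
        refine ⟨fun _ => ?_, fun hc => absurd hc (by simpa using ha)⟩
        simp only [run_seq, run_emit, run_assign]
        refine (ih _ ?_).mono fun τ' t ⟨hm, ht⟩ => ⟨hm, ?_⟩
        · simpa using hl
        · simp
          omega
  rw [run_call]
  simp only [procedures, outputBody, run_seq, run_assign]
  refine (loop cs _ (by simpa using hl)).mono fun τ t ⟨hm, ht⟩ => ?_
  simp at hm ⊢
  rw [hm]
  exact ⟨rfl, N', h', by omega⟩

/-- The absorption of the vertex `x` by `w`. -/
def absorbVertex : Cmd :=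
  .seq (uniteAlpha (.var .w) (.var .x)) <|
  .seq (addEdge (.var .w) (.get .parent (.var .x)) (.var .x)) <|
  .seq (.set .deg (.var .w) (.get .deg (.var .w) + .get .deg (.var .x) - 2))
    (.assign .x (.get .next (.var .x)))

theorem run_absorbVertex {σ : State} {L : Finset ℕ} {N : ℕ} (h : Heap σ.mem L N)
    (hw : σ.var .w ∈ L) (hx : σ.var .x ∈ L) (hwx : σ.var .w ≠ σ.var .x) :
    Run absorbVertex σ fun τ t => τ.var .w = σ.var .w ∧ τ.var .u = σ.var .u ∧
      τ.var .x = σ.mem .next (σ.var .x) ∧ Agree σ.mem τ.mem ∧ τ.mem .next = σ.mem .next ∧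
      ∃ N', Heap τ.mem (L.erase (σ.var .x)) N' ∧ t + 20 * N' ≤ 20 * N + 150 := by
  simp only [absorbVertex, run_seq, run_set, run_assign]
  refine (run_uniteAlpha h hw hx hwx).mono ?_
  rintro τ t ⟨hv, ha, hn, ⟨N₁, hN, hh⟩, ht⟩
  refine (run_addEdge hh (by rw [hv]; exact Finset.mem_erase.2 ⟨hwx, hw⟩)).mono ?_
  rintro τ' t' ⟨hv', ha', hn', hh', ht'⟩
  simp at ht'
  simp [hv, hv', hn, hn']
  refine ⟨ha.trans (ha'.trans ?_), N₁ + 1, hh'.congr ?_ ?_ ?_ ?_, by omega⟩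
  · constructor <;> simp
  all_goals simp

/-- What remains of a path after a prefix has been absorbed: the rest `E'` of the path `E` is a
path from `x` in the set `L'` of the remaining vertices. -/
structure Absorbed (m m' : Arr → ℕ → ℕ) (x : ℕ) (E E' : List ℕ) (L L' : Finset ℕ) : Prop where
  agree : Agree m m'
  next : m' .next = m .next
  linked : LinkedCells (m .next) x E'
  live : ∀ a ∈ E', a ∈ L'
  sub : ∀ a ∈ E', a ∈ E
  mem : ∀ a ∈ L, a ∉ E → a ∈ L'

/-- Each round kills the vertex `x`, and its credit of 200 covers the 150 of `run_absorbVertex`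
together with the test. The loops of both absorption procedures are instances: of the guard it is
only required that it fails at the null pointer, and where else it stops does not matter, since any
suffix of the path is again a path of live vertices. -/
theorem run_absorb_while {b : Cond} (hb : ∀ σ, b.eval σ = true → σ.var .x ≠ 0)
    (hc : b.cost ≤ 30) {E : List ℕ} {σ : State} {L : Finset ℕ} {N : ℕ} (h : Heap σ.mem L N)
    (hw : σ.var .w ∈ L) (hE : LinkedCells (σ.mem .next) (σ.var .x) E) (hL : ∀ a ∈ E, a ∈ L)
    (hwE : σ.var .w ∉ E) :
    Run (.while b absorbVertex) σ fun τ t => b.eval τ = false ∧ τ.var .w = σ.var .w ∧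
      τ.var .u = σ.var .u ∧ ∃ E' L' N', Absorbed σ.mem τ.mem (τ.var .x) E E' L L' ∧
        Heap τ.mem L' N' ∧ t + credit L' N' ≤ credit L N + 40 := by
  induction E generalizing σ L N with
  | nil =>
    rw [run_while]
    have hx : σ.var .x = 0 := by
      by_contra h0
      obtain ⟨_, h, -⟩ := hE.eq_cons h0
      simp at h
    refine ⟨fun h0 => absurd hx (hb _ h0), fun h0 => ⟨h0, rfl, rfl, [], L, N, ?_, h, by omega⟩⟩
    exact ⟨.refl _, rfl, hE, hL, fun _ => id, fun _ ha _ => ha⟩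
  | cons a E ih =>
    rw [run_while]
    refine ⟨fun h0 => ?_, fun h0 => ⟨h0, rfl, rfl, a :: E, L, N, ?_, h, by omega⟩⟩
    · have hnd := hE.nodup
      obtain ⟨_, he, hE⟩ := hE.eq_cons (hb _ h0)
      obtain ⟨rfl, rfl⟩ := List.cons.inj he
      have hwx : σ.var .w ≠ σ.var .x := fun h => hwE (by simp [h])
      have hx : σ.var .x ∈ L := hL _ (by simp)
      refine (run_absorbVertex h hw hx hwx).mono ?_
      rintro τ t ⟨hv, hu, hvx, ha, hn, N₁, hh, ht⟩
      refine (ih hh ?_ ?_ ?_ ?_).mono ?_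
      · rw [hv]
        exact Finset.mem_erase.2 ⟨hwx, hw⟩
      · rwa [hn, hvx]
      · intro b hb
        refine Finset.mem_erase.2 ⟨?_, hL b (by simp [hb])⟩
        rintro rfl
        exact (List.nodup_cons.1 hnd).1 hb
      · rw [hv]
        exact fun h => hwE (by simp [h])
      rintro τ' t' ⟨hbf, hv', hu', E', L', N', habs, hh', ht'⟩
      refine ⟨hbf, hv'.trans hv, hu'.trans hu, E', L', N', ?_, hh', ?_⟩
      · exact ⟨ha.trans habs.agree, habs.next.trans hn, hn ▸ habs.linked, habs.live,
          fun b hb => List.mem_cons_of_mem _ (habs.sub b hb), fun b hb hbE =>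
            habs.mem b (Finset.mem_erase.2 ⟨fun h => hbE (by simp [h]), hb⟩)
              fun h => hbE (by simp [h])⟩
      · have h1 := credit_erase hx N
        unfold credit at *
        omega
    · exact ⟨.refl _, rfl, hE, hL, fun _ => id, fun _ ha _ => ha⟩

theorem absorbEarBody_eq : absorbEarBody = when (.eq (.var .null) 0)
    (.ite (.eq (.var .u) 0) (addEar (.var .w) (.var .w))
      (.seq (.assign .x (.var .u))
        (.seq (.seq absorbVertex (.while (.not (.eq (.var .x) 0)) absorbVertex))
          (addEar (.var .w) (.var .u))))) := rfl

theorem absorbSubpathBody_eq : absorbSubpathBody =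
    .seq (.set .deg (.var .w) (.get .deg (.var .w) - 2))
      (.seq (.assign .x (.get .next (.var .w)))
        (.seq (.while (.and (neq (.var .x) 0) (isDescendant (.var .u) (.var .x))) absorbVertex)
          (.set .next (.var .w) (.var .x)))) := rfl

/-- The constant 800 covers the work outside the loop; the vertices of `E` pay for themselves. At
most the vertices of `E` die, and none if `Null` is set, so the other path known to the caller stays
live. -/
theorem run_absorbEar {w u : Expr} {null : Expr} {σ : State} {L : Finset ℕ} {N : ℕ} {E : List ℕ}
    (h : Heap σ.mem L N) (hw : w.eval σ ∈ L)
    (hE : null.eval σ = 0 → LinkedCells (σ.mem .next) (u.eval σ) E ∧ (∀ a ∈ E, a ∈ L) ∧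
      w.eval σ ∉ E) (hc : w.cost + u.cost + null.cost ≤ 10) :
    Run (.call .absorbEar [(.w, w), (.u, u), (.null, null)] []) σ fun τ t => τ.var = σ.var ∧
      Agree σ.mem τ.mem ∧ τ.mem .next = σ.mem .next ∧ ∃ L' N', Heap τ.mem L' N' ∧
      (∀ a ∈ L, null.eval σ ≠ 0 ∨ a ∉ E → a ∈ L') ∧
      t + credit L' N' ≤ credit L N + 800 := by
  rw [run_call]
  simp only [procedures, absorbEarBody_eq, run_when, run_ite, run_seq, run_assign]
  refine ⟨fun h0 => ⟨fun hu => ?_, fun hu => ?_⟩, fun h0 => ?_⟩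
  · refine (run_addEar (L := L) (N := N) (by simpa using h) (by simpa using hw)).mono ?_
    rintro τ t ⟨hv, ha, hn, N', hh, ht⟩
    refine ⟨by simp, ha, hn, L, N', hh, fun a ha _ => ha, ?_⟩
    simp [credit] at ht ⊢
    omega
  · simp at h0 hu
    obtain ⟨hE, hEL, hwE⟩ := hE h0
    have hnd := hE.nodup
    obtain ⟨F, rfl, hF⟩ := hE.eq_cons hu
    have hwu : w.eval σ ≠ u.eval σ := fun h => hwE (by simp [h])
    have huL : u.eval σ ∈ L := hEL _ (by simp)
    refine (run_absorbVertex (L := L) (N := N) (by simpa using h) (by simpa using hw)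
      (by simpa using huL) (by simpa using hwu)).mono ?_
    rintro τ t ⟨hv, hu', hx, ha, hn, N₁, hh, ht⟩
    simp at hv hu' hx ha hn hh
    refine (run_absorb_while (E := F) (by simp) (by simp) hh ?_ ?_ ?_ ?_).mono ?_
    · rw [hv]
      exact Finset.mem_erase.2 ⟨hwu, hw⟩
    · rwa [hn, hx]
    · intro b hb
      refine Finset.mem_erase.2 ⟨?_, hEL b (by simp [hb])⟩
      rintro rfl
      exact (List.nodup_cons.1 hnd).1 hb
    · rw [hv]
      exact fun h => hwE (by simp [h])
    rintro τ' t' ⟨-, hv', -, E', L', N', habs, hh', ht'⟩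
    have hmem : ∀ a ∈ L, null.eval σ ≠ 0 ∨ a ∉ u.eval σ :: F → a ∈ L' := by
      intro a haL haF
      have haF := haF.resolve_left (not_not_intro h0)
      exact habs.mem a (Finset.mem_erase.2 ⟨fun h => haF (by simp [h]), haL⟩)
        fun h => haF (by simp [h])
    refine (run_addEar hh' ?_).mono ?_
    · rw [hv', hv]
      exact hmem _ hw (.inr hwE)
    rintro τ'' t'' ⟨-, ha'', hn'', N'', hh'', ht''⟩
    refine ⟨by simp, ha.trans (habs.agree.trans ha''), hn''.trans (habs.next.trans hn), L', N'',
      hh'', hmem, ?_⟩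
    have h1 := credit_erase huL N
    simp [credit] at *
    omega
  · refine ⟨by simp, .refl _, trivial, L, N, h, fun a ha _ => ha, ?_⟩
    simp
    omega

/-- A prefix of the path of `w` is absorbed and `next(w)` is moved to the remaining suffix; this
write does not damage the suffix because `w` is not on the path. -/
theorem run_absorbSubpath {u : Expr} {σ : State} {L : Finset ℕ} {N : ℕ} {E : List ℕ}
    (h : Heap σ.mem L N) (hw : σ.var .w ∈ L)
    (hE : LinkedCells (σ.mem .next) (σ.mem .next (σ.var .w)) E) (hEL : ∀ a ∈ E, a ∈ L)
    (hwE : σ.var .w ∉ E) (hc : u.cost ≤ 10) :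
    Run (.call .absorbSubpath [(.w, .var .w), (.u, u)] []) σ fun τ t => τ.var = σ.var ∧
      Agree σ.mem τ.mem ∧ (∀ a, a ≠ σ.var .w → τ.mem .next a = σ.mem .next a) ∧
      ∃ E' L' N', LinkedCells (τ.mem .next) (τ.mem .next (σ.var .w)) E' ∧ (∀ a ∈ E', a ∈ L') ∧
      (∀ a ∈ E', a ∈ E) ∧ (∀ a ∈ L, a ∉ E → a ∈ L') ∧ Heap τ.mem L' N' ∧
      t + credit L' N' ≤ credit L N + 200 := by
  rw [run_call]
  simp only [procedures, absorbSubpathBody_eq, run_seq, run_assign, run_set]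
  refine (run_absorb_while (E := E) (L := L) (N := N) (by simp +contextual) (by simp [isDescendant])
    (h.congr (by simp) (by simp) (by simp) (by simp)) (by simpa using hw) (by simpa using hE)
    hEL (by simpa using hwE)).mono ?_
  rintro τ t ⟨-, hv, -, E', L', N', ⟨ha, hn, hl, hE', hE'E, hL⟩, hh, ht⟩
  simp at hv hn hl
  have hwE' : σ.var .w ∉ E' := fun h => hwE (hE'E _ h)
  refine ⟨by simp, Agree.trans ?_ (ha.trans ?_), ?_, E', L', N', ?_, hE', hE'E, hL, ?_, ?_⟩
  · constructor <;> simp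
  · constructor <;> simp
  · intro a haw
    simp [hv, hn, haw]
  · simp only [State.setMem, Expr.eval, Function.update_self, hv, hn]
    refine hl.congr fun k hk => Function.update_of_ne ?_ _ _
    rintro rfl
    exact hwE' hk
  · exact hh.congr (by simp) (by simp) (by simp) (by simp)
  · simp
    omega

theorem run_addEdge_when {b : Cond} {x : Var} {p q : Expr} {σ : State} {L : Finset ℕ} {N : ℕ}
    (h : Heap σ.mem L N) (hx : σ.var x ∈ L) :
    Run (when b (addEdge (.var x) p q)) σ fun τ t => τ.var = σ.var ∧ Agree σ.mem τ.mem ∧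
      τ.mem .next = σ.mem .next ∧
      ∃ N', Heap τ.mem L N' ∧ t + 20 * N' ≤ 20 * N + (b.cost + p.cost + q.cost + 70) := by
  rw [run_when]
  refine ⟨fun _ => ?_, fun _ => ⟨rfl, .refl _, rfl, N, h, by omega⟩⟩
  refine (run_addEdge h hx).mono ?_
  rintro τ t ⟨hv, ha, hn, hh, ht⟩
  exact ⟨hv, ha, hn, _, hh, by omega⟩

/-- All three cases cost a constant and add at most one cell. For the search only two outcomes
matter: there is no path to hand over (`Null`), or the path shortened by its first vertex is handed
over. -/
theorem run_ejection {σ : State} {L : Finset ℕ} {N : ℕ} (h : Heap σ.mem L N)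
    (hu : σ.var .u ∈ L) (hnull : σ.var .null = 0) :
    Run (.ite (.eq (.get .deg (.var .u)) 1)
      (.seq (.assign .null 1) (.set .deg (.var .w) (.get .deg (.var .w) - 1)))
      (.ite (.eq (.get .next (.var .u)) 0)
        (.seq (.assign .s (.get .earS (.var .u)))
        (.seq (.assign .d (.get .earT (.var .u)))
        (.seq (when (neq (.var .w) (.var .d))
          (.seq (.set .earS (.var .u) (.var .w)) (.set .earT (.var .u) (.var .d))))
        (.seq (when (neq (.var .u) (.var .s)) (addEdge (.var .u) (.var .u) (.var .s)))
          (.assign .null 1)))))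
        (.seq (.assign .y (.get .next (.var .u)))
        (.seq (.assign .s (.get .parent (.var .y)))
        (.seq (.set .parent (.var .y) (.var .w))
        (.seq (when (neq (.var .u) (.var .s)) (addEdge (.var .u) (.var .u) (.var .s)))
          (.assign .u (.var .y)))))))) σ fun τ t =>
      τ.var .x = σ.var .x ∧
      (τ.var .null = 1 ∨ τ.var .null = 0 ∧ τ.var .u = σ.mem .next (σ.var .u)) ∧
      Agree σ.mem τ.mem ∧ τ.mem .next = σ.mem .next ∧
      ∃ N', Heap τ.mem L N' ∧ t + 20 * N' ≤ 20 * N + 200 := by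
  rw [run_ite, run_ite]
  refine ⟨fun _ => ?_, fun _ => ⟨fun _ => ?_, fun _ => ?_⟩⟩
  · simp only [run_seq, run_assign, run_set]
    refine ⟨by simp, by simp, by constructor <;> simp, by simp, N,
      h.congr (by simp) (by simp) (by simp) (by simp), ?_⟩
    simp
    omega
  · rw [run_seq, run_assign, run_seq, run_assign, run_seq]
    have ear : ∀ τ : State, Run (when (neq (.var .w) (.var .d))
        (.seq (.set .earS (.var .u) (.var .w)) (.set .earT (.var .u) (.var .d)))) τ fun τ' t =>
        τ'.var = τ.var ∧ Agree τ.mem τ'.mem ∧ τ'.mem .next = τ.mem .next ∧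
        (∀ M, Heap τ.mem L M → Heap τ'.mem L M) ∧ t ≤ 20 := by
      intro τ
      simp only [run_when, run_seq, run_set]
      refine ⟨fun _ => ⟨rfl, by constructor <;> simp, by simp,
        fun M h => h.congr (by simp) (by simp) (by simp) (by simp), by simp⟩,
        fun _ => ⟨trivial, .refl _, trivial, fun _ => id, by simp⟩⟩
    refine (ear _).mono ?_
    rintro τ t ⟨hv, ha, hn, hh, ht⟩
    rw [run_seq]
    refine (run_addEdge_when (hh N (by simpa using h)) (by simpa [hv] using hu)).mono ?_
    rintro τ' t' ⟨hv', ha', hn', N', hh', ht'⟩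
    rw [run_assign]
    simp at ha hn ht'
    refine ⟨by simp [hv, hv'], by simp, ha.trans ha', hn'.trans hn, N', hh', ?_⟩
    simp
    omega
  · rw [run_seq, run_assign, run_seq, run_assign, run_seq, run_set, run_seq]
    refine (run_addEdge_when (L := L) (N := N) ?_ (by simpa using hu)).mono ?_
    · exact h.congr (by simp) (by simp) (by simp) (by simp)
    rintro τ t ⟨hv, ha, hn, N', hh, ht⟩
    rw [run_assign]
    simp at hn ht
    refine ⟨by simp [hv], by simp [hv, hnull], .trans ?_ ha, hn, N', hh, ?_⟩
    · constructor <;> simp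
    · simp
      omega

theorem run_genAuxEdges {σ : State} {L : Finset ℕ} {N : ℕ}
    (h : Heap σ.mem L N) (hu : σ.var .u ∈ L) (hnull : σ.var .null = 0) :
    Run (.call .genAuxEdges [(.w, .var .w), (.u, .var .u), (.null, .var .null)]
      [(.u, .u), (.null, .null)]) σ fun τ t =>
      τ.var .w = σ.var .w ∧ τ.var .c = σ.var .c ∧ τ.var .e = σ.var .e ∧
      (τ.var .null = 1 ∨ τ.var .null = 0 ∧ τ.var .u = σ.mem .next (σ.var .u)) ∧
      Agree σ.mem τ.mem ∧ τ.mem .next = σ.mem .next ∧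
      ∃ N', Heap τ.mem (L.erase (σ.var .u)) N' ∧ t + 20 * N' ≤ 20 * N + 300 := by
  rw [run_call]
  simp only [procedures, genAuxEdgesBody]
  rw [run_seq, run_assign, run_seq]
  refine (run_ejection (L := L) (N := N) (by simpa using h) (by simpa using hu)
    (by simpa using hnull)).mono ?_
  rintro τ t ⟨hx, hd, ha, hn, N', hh, ht⟩
  simp at hx hd ha hn
  refine (run_output hh (by rwa [hx])).mono ?_
  rintro τ' t' ⟨hv, hm, N'', hh', ht'⟩
  rw [hx] at hh'
  refine ⟨by simp, by simp, by simp, by simpa [hv] using hd, by rwa [hm], by rwa [hm], N'', hh', ?_⟩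
  simp
  omega

/-! ### The search -/

/-- The invariant of the search: `cells a` are the cells of the adjacency list of the vertex
`a ∈ {1, …, n}`. -/
structure Inv (n : ℕ) (cells : ℕ → List ℕ) (m : Arr → ℕ → ℕ) (L : Finset ℕ) (N : ℕ) : Prop where
  heap : Heap m L N
  cnt_pos : 0 < m .cnt 0
  fresh : ∀ a ∈ Finset.Icc 1 n, m .dfs a = 0 → a ∈ L ∧ m .incHead a = 0
  adj : ∀ a ∈ Finset.Icc 1 n, LinkedCells (m .adjLink) (m .adjHead a) (cells a)
  vertex : ∀ a ∈ Finset.Icc 1 n, ∀ k ∈ cells a, m .adjVertex k ∈ Finset.Icc 1 n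

/-- `m'` may arise from `m` by a part of the search that does not touch the vertices visited
before. -/
structure Ext (m m' : Arr → ℕ → ℕ) (L L' : Finset ℕ) : Prop where
  dfs : ∀ a, m .dfs a ≠ 0 → m' .dfs a = m .dfs a
  next : ∀ a, m .dfs a ≠ 0 → m' .next a = m .next a
  incHead : ∀ a, m .dfs a ≠ 0 → m' .incHead a = m .incHead a
  live : ∀ a ∈ L, m .dfs a ≠ 0 → a ∈ L'
  free : m .free 0 ≤ m' .free 0
  incLink : ∀ k < m .free 0, m' .incLink k = m .incLink k
  adjHead : m' .adjHead = m .adjHead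
  adjVertex : m' .adjVertex = m .adjVertex
  adjLink : m' .adjLink = m .adjLink

theorem Ext.trans {m m' m'' : Arr → ℕ → ℕ} {L L' L'' : Finset ℕ} (h : Ext m m' L L')
    (h' : Ext m' m'' L' L'') : Ext m m'' L L'' := by
  have hd : ∀ a, m .dfs a ≠ 0 → m' .dfs a ≠ 0 := fun a ha => by rwa [h.dfs a ha]
  exact ⟨fun a ha => (h'.dfs a (hd a ha)).trans (h.dfs a ha),
    fun a ha => (h'.next a (hd a ha)).trans (h.next a ha),
    fun a ha => (h'.incHead a (hd a ha)).trans (h.incHead a ha),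
    fun a haL ha => h'.live a (h.live a haL ha) (hd a ha), h.free.trans h'.free,
    fun k hk => (h'.incLink k (hk.trans_le h.free)).trans (h.incLink k hk),
    h'.adjHead.trans h.adjHead, h'.adjVertex.trans h.adjVertex, h'.adjLink.trans h.adjLink⟩

/-- The situation while `w` is processed, where `m₀`, `L₀` describe the memory when the processing
of `w` began: `D` is the path of `w` without `w` itself, and `I` is the list `Inc(w)`. -/
structure Loc (n : ℕ) (cells : ℕ → List ℕ) (m₀ : Arr → ℕ → ℕ) (L₀ : Finset ℕ) (w : ℕ)
    (m : Arr → ℕ → ℕ) (L : Finset ℕ) (N : ℕ) (D I : List ℕ) : Prop where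
  inv : Inv n cells m L N
  ext : Ext m₀ m L₀ L
  vertex : w ∈ Finset.Icc 1 n
  fresh : m₀ .dfs w = 0
  visited : m .dfs w ≠ 0
  live : w ∈ L
  path : LinkedCells (m .next) (m .next w) D
  mem_path : ∀ x ∈ D, x ∈ L ∧ m₀ .dfs x = 0 ∧ m .dfs x ≠ 0 ∧ x ≠ w
  inc : LinkedCells (m .incLink) (m .incHead w) I
  inc_lt : ∀ k ∈ I, k < m .free 0

/-- The time set aside for the unvisited vertices and their adjacency lists. -/
def unvisitedCredit (n : ℕ) (cells : ℕ → List ℕ) (m : Arr → ℕ → ℕ) : ℕ :=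
  ∑ a ∈ Finset.Icc 1 n with m .dfs a = 0, (5000 + 5000 * (cells a).length)

theorem unvisitedCredit_congr {n : ℕ} {cells : ℕ → List ℕ} {m m' : Arr → ℕ → ℕ}
    (h : m' .dfs = m .dfs) : unvisitedCredit n cells m' = unvisitedCredit n cells m := by
  unfold unvisitedCredit
  rw [h]

theorem unvisitedCredit_visit {n : ℕ} {cells : ℕ → List ℕ} {m m' : Arr → ℕ → ℕ} {w k : ℕ}
    (hw : w ∈ Finset.Icc 1 n) (h0 : m .dfs w = 0) (hk : k ≠ 0)
    (h : m' .dfs = Function.update (m .dfs) w k) :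
    unvisitedCredit n cells m' + (5000 + 5000 * (cells w).length) =
      unvisitedCredit n cells m := by
  unfold unvisitedCredit
  have : (Finset.Icc 1 n).filter (fun a => m' .dfs a = 0) =
      ((Finset.Icc 1 n).filter fun a => m .dfs a = 0).erase w := by
    ext a
    rw [h]
    rcases eq_or_ne a w with rfl | haw
    · simp [hk]
    · simp [haw]
  rw [this]
  exact Finset.sum_erase_add _ (fun a => 5000 + 5000 * (cells a).length)
    (Finset.mem_filter.2 ⟨hw, h0⟩)

/-! ### Stability of the situation at a vertex. -/

section

variable {n : ℕ} {cells : ℕ → List ℕ} {m₀ m m' : Arr → ℕ → ℕ} {L₀ L L' : Finset ℕ}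
  {w N N' : ℕ} {D D' I E : List ℕ}

/-- For changes made by the auxiliary procedures on behalf of `w`. Vertices may die only if they
were discovered during the processing of `w` and differ from `w`; hence older vertices, unvisited
vertices and `w` stay live. -/
theorem Loc.update (h : Loc n cells m₀ L₀ w m L N D I) (ha : Agree m m')
    (hn : ∀ a, a ≠ w → m' .next a = m .next a) (hh : Heap m' L' N')
    (hL : ∀ a ∈ L, a ∉ L' → m₀ .dfs a = 0 ∧ m .dfs a ≠ 0 ∧ a ≠ w)
    (hp : LinkedCells (m' .next) (m' .next w) D')
    (hD : ∀ x ∈ D', x ∈ L' ∧ m₀ .dfs x = 0 ∧ m .dfs x ≠ 0 ∧ x ≠ w) :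
    Loc n cells m₀ L₀ w m' L' N' D' I where
  inv := by
    refine ⟨hh, ha.cnt ▸ h.inv.cnt_pos, fun a hau h0 => ?_, ?_, ?_⟩
    · rw [ha.dfs] at h0
      obtain ⟨haL, hi⟩ := h.inv.fresh a hau h0
      refine ⟨?_, ha.incHead ▸ hi⟩
      by_contra hc
      exact (hL a haL hc).2.1 h0
    · rw [ha.adjLink, ha.adjHead]
      exact h.inv.adj
    · rw [ha.adjVertex]
      exact h.inv.vertex
  ext := by
    refine ⟨fun a h0 => by rw [ha.dfs, h.ext.dfs a h0], fun a h0 => ?_,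
      fun a h0 => by rw [ha.incHead, h.ext.incHead a h0], fun a haL h0 => ?_,
      h.ext.free.trans ha.free, fun k hk => by rw [ha.incLink, h.ext.incLink k hk],
      ha.adjHead.trans h.ext.adjHead, ha.adjVertex.trans h.ext.adjVertex,
      ha.adjLink.trans h.ext.adjLink⟩
    · rw [hn a fun haw => h0 (haw ▸ h.fresh), h.ext.next a h0]
    · by_contra hc
      exact h0 (hL a (h.ext.live a haL h0) hc).1
  vertex := h.vertex
  fresh := h.fresh
  visited := ha.dfs ▸ h.visited
  live := by
    by_contra hc
    exact (hL w h.live hc).2.2 rfl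
  path := hp
  mem_path := by rwa [ha.dfs]
  inc := by
    rw [ha.incLink, ha.incHead]
    exact h.inc
  inc_lt k hk := (h.inc_lt k hk).trans_le ha.free

/-- Everything that `Loc` records about `w` concerns vertices already visited when the call for `u`
started, and cells allocated before it; by `Ext` the call preserves both. -/
theorem Loc.child {u : ℕ} {J : List ℕ} (h : Loc n cells m₀ L₀ w m L N D I)
    (h' : Loc n cells m L u m' L' N' E J) : Loc n cells m₀ L₀ w m' L' N' D I where
  inv := h'.inv
  ext := h.ext.trans h'.ext
  vertex := h.vertex
  fresh := h.fresh
  visited := by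
    rw [h'.ext.dfs w h.visited]
    exact h.visited
  live := h'.ext.live w h.live h.visited
  path := by
    rw [h'.ext.next w h.visited]
    exact h.path.congr fun k hk => h'.ext.next k (h.mem_path k hk).2.2.1
  mem_path x hx := by
    obtain ⟨h1, h2, h3, h4⟩ := h.mem_path x hx
    exact ⟨h'.ext.live x h1 h3, h2, by rwa [h'.ext.dfs x h3], h4⟩
  inc := by
    rw [h'.ext.incHead w h.visited]
    exact h.inc.congr fun k hk => h'.ext.incLink k (h.inc_lt k hk)
  inc_lt k hk := (h.inc_lt k hk).trans_le h'.ext.free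

theorem Loc.not_mem_path (h : Loc n cells m₀ L₀ w m L N D I) : w ∉ D :=
  fun hw => (h.mem_path w hw).2.2.2 rfl

theorem Loc.new (h : Loc n cells m₀ L₀ w m L N D I) {a : ℕ} (ha : m .dfs a = 0) :
    m₀ .dfs a = 0 := by
  by_contra hc
  exact hc (h.ext.dfs a hc ▸ ha)

end

/-- The final situation of a step in the processing of `w` that preserves the variables `w`, `c`
and for which the time `B` was set aside. -/
def StepPost (n : ℕ) (cells : ℕ → List ℕ) (m₀ : Arr → ℕ → ℕ) (L₀ : Finset ℕ) (w c B : ℕ)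
    (τ : State) (t : ℕ) : Prop :=
  τ.var .w = w ∧ τ.var .c = c ∧ ∃ L N D I, Loc n cells m₀ L₀ w τ.mem L N D I ∧
    t + unvisitedCredit n cells τ.mem + credit L N + 400 * I.length ≤ B

theorem StepPost.mono {n : ℕ} {cells : ℕ → List ℕ} {m₀ : Arr → ℕ → ℕ} {L₀ : Finset ℕ}
    {w c B B' t t' : ℕ} {τ : State} (h : StepPost n cells m₀ L₀ w c B τ t)
    (hB : t' + B ≤ t + B') : StepPost n cells m₀ L₀ w c B' τ t' := by
  obtain ⟨h1, h2, L, N, D, I, h3, h4⟩ := h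
  exact ⟨h1, h2, L, N, D, I, h3, by omega⟩

/-! ### Amortized cost of one adjacency entry. -/

section

variable {n : ℕ} {cells : ℕ → List ℕ} {m₀ : Arr → ℕ → ℕ} {L₀ L : Finset ℕ}
  {w N : ℕ} {D I E : List ℕ} {σ : State}

theorem run_processOutgoing (h : Loc n cells m₀ L₀ w σ.mem L N D I) (hw : σ.var .w = w) :
    Run processOutgoing σ (StepPost n cells m₀ L₀ w (σ.var .c)
      (unvisitedCredit n cells σ.mem + credit L N + 400 * I.length + 2000)) := by
  subst hw
  simp only [processOutgoing, run_ite, run_seq, run_set]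
  refine ⟨fun _ => ?_, fun _ => ?_⟩
  · refine (run_absorbEar (w := .var .w) (u := .get .next (.var .w)) (null := 0) (E := D)
      h.inv.heap h.live
      (fun _ => ⟨h.path, fun a ha => (h.mem_path a ha).1, h.not_mem_path⟩) (by simp)).mono ?_
    rintro τ t ⟨hv, ha, hn, L', N', hh, hL, ht⟩
    simp at hL
    refine ⟨by simp [hv], by simp [hv], L', N', [], I,
      h.update (ha.trans ?_) ?_ (hh.congr ?_ ?_ ?_ ?_) ?_ ?_ (by simp), ?_⟩
    · constructor <;> simp
    · intro a haw
      simp [hv, hn, haw]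
    any_goals simp
    -- Only vertices of the old path `D` can have died, and these were discovered during the
    -- processing of `w`.
    · intro a haL haL'
      by_contra hc
      exact haL' (hL a haL fun haD => hc (by simpa using (h.mem_path a haD).2))
    · simp [hv, LinkedCells.zero_iff]
    · rw [unvisitedCredit_congr (m := σ.mem) (by simp [ha.dfs])]
      simp [lexLt, isDescendant]
      omega
  · refine (run_addEdge h.inv.heap h.live).mono ?_
    rintro τ t ⟨hv, ha, hn, hh, ht⟩
    refine ⟨by simp [hv], by simp [hv], L, N + 1, D, I,
      h.update ha (by simp [hn]) hh (fun a ha hc => absurd ha hc) (by rw [hn]; exact h.path)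
        h.mem_path, ?_⟩
    rw [unvisitedCredit_congr ha.dfs]
    simp [lexLt, isDescendant, credit] at ht ⊢
    omega

/-- Of the allotted 1000, a part of 400 becomes the credit of the new cell of `Inc(w)`. -/
theorem run_addInc (h : Loc n cells m₀ L₀ w σ.mem L N D I) (hw : σ.var .w = w) :
    Run (addInc (.var .w) (.var .u)) σ (StepPost n cells m₀ L₀ w (σ.var .c)
      (unvisitedCredit n cells σ.mem + credit L N + 400 * I.length + 1000)) := by
  subst hw
  simp only [addInc, run_seq, run_set]
  have hinc : ∀ k ∈ I, k ≠ σ.mem .free 0 := fun k hk => (h.inc_lt k hk).ne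
  have hfree : σ.mem .free 0 ≠ 0 := by
    obtain ⟨A, hA, -⟩ := h.inv.heap
    exact hA.free_pos.ne'
  have hfresh : ∀ a, σ.mem .dfs a = 0 → a ≠ σ.var .w := by
    rintro a ha rfl
    exact h.visited ha
  have hfresh₀ : ∀ a, m₀ .dfs a ≠ 0 → a ≠ σ.var .w := by
    rintro a ha rfl
    exact ha h.fresh
  have hlt : ∀ k < m₀ .free 0, k ≠ σ.mem .free 0 := fun k hk => (hk.trans_le h.ext.free).ne
  refine ⟨by simp, by simp, L, N, D, σ.mem .free 0 :: I,
    ⟨⟨h.inv.heap.congr ?_ ?_ ?_ ?_, ?_, ?_, ?_, ?_⟩, ⟨?_, ?_, ?_, ?_, ?_, ?_, ?_, ?_, ?_⟩,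
      h.vertex, h.fresh, ?_, h.live, ?_, ?_, ?_, ?_⟩, ?_⟩
  any_goals simp
  · exact h.inv.cnt_pos
  · intro a h1 h2 h0
    rw [Function.update_of_ne (hfresh a h0)]
    exact h.inv.fresh a (Finset.mem_Icc.2 ⟨h1, h2⟩) h0
  · simpa using h.inv.adj
  · simpa using h.inv.vertex
  · exact h.ext.dfs
  · exact h.ext.next
  · intro a h0
    rw [Function.update_of_ne (hfresh₀ a h0)]
    exact h.ext.incHead a h0
  · exact h.ext.live
  · exact h.ext.free.trans (Nat.le_succ _)
  · intro k hk
    rw [Function.update_of_ne (hlt k hk)]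
    exact h.ext.incLink k hk
  · exact h.ext.adjHead
  · exact h.ext.adjVertex
  · exact h.ext.adjLink
  · exact h.visited
  · exact h.path
  · exact h.mem_path
  · refine .cons hfree ?_
    rw [Function.update_self]
    exact h.inc.congr fun k hk => Function.update_of_ne (hinc k hk) _ _
  · exact fun k hk => (h.inc_lt k hk).le
  · rw [unvisitedCredit_congr (m := σ.mem) (by simp)]
    omega

/-- The path `E` that a processed child of `w` hands over to `w`. -/
structure Handed (m₀ m : Arr → ℕ → ℕ) (w : ℕ) (L : Finset ℕ) (D E : List ℕ) (a null : ℕ) :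
    Prop where
  null : null = 0 ∧ LinkedCells (m .next) a E ∨ null = 1 ∧ E = []
  mem : ∀ x ∈ E, x ∈ L ∧ m₀ .dfs x = 0 ∧ m .dfs x ≠ 0 ∧ x ≠ w
  disjoint : ∀ x ∈ E, x ∉ D

/-- The part of `processChild` that ejects the child if its degree is at most two. -/
def ejectChild : Cmd :=
  when (.lt (.get .deg (.var .u)) 3)
    (.call .genAuxEdges [(.w, .var .w), (.u, .var .u), (.null, .var .null)]
      [(.u, .u), (.null, .null)])

/-- The last part of `processChild`. -/
def mergeChild : Cmd :=
  .ite (.not (lexLt (.var .w) (.get .earS (.var .u)) (.get .earT (.var .u))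
      (.get .earS (.var .w)) (.get .earT (.var .w))))
    (.seq (.call .absorbEar [(.w, .var .w), (.u, .var .u), (.null, .var .null)] [])
      (when (.and (.eq (.var .null) 1) (.and (neq (.get .earT (.var .u)) 0)
        (.lt (.get .dfs (.get .earT (.var .u))) (.get .dfs (.var .w)))))
        (addEar (.var .w) (.var .u))))
    (.seq (.call .absorbEar [(.w, .var .w), (.u, .get .next (.var .w)), (.null, 0)] [])
      (.seq (.ite (.eq (.var .null) 1) (.set .next (.var .w) 0) (.set .next (.var .w) (.var .u)))
        (.seq (.set .earS (.var .w) (.get .earS (.var .u)))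
          (.set .earT (.var .w) (.get .earT (.var .u))))))

theorem processChild_eq : processChild = .seq (.assign .null 0)
    (.seq (.call .constructAuxSubgraph
        [(.w, .var .u), (.v, .var .w), (.e, .get .adjEdge (.var .c))] [])
      (.seq (.set .nd (.var .w) (.get .nd (.var .w) + .get .nd (.var .u)))
        (.seq ejectChild mergeChild))) := rfl

/-- One of the two disjoint paths is absorbed and the other one survives as the path of `w`: in the
first branch `E` disappears and `D` stays, in the second `D` disappears and `E` takes its place. -/
theorem run_mergeChild (h : Loc n cells m₀ L₀ w σ.mem L N D I) (hw : σ.var .w = w)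
    (hE : Handed m₀ σ.mem w L D E (σ.var .u) (σ.var .null)) :
    Run mergeChild σ (StepPost n cells m₀ L₀ w (σ.var .c)
      (unvisitedCredit n cells σ.mem + credit L N + 400 * I.length + 2000)) := by
  subst hw
  rw [mergeChild, run_ite]
  refine ⟨fun _ => ?_, fun _ => ?_⟩
  · rw [run_seq]
    refine (run_absorbEar (E := E) h.inv.heap (by simpa using h.live) ?_ (by simp)).mono ?_
    · intro h0
      simp at h0
      refine ⟨?_, fun x hx => (hE.mem x hx).1, fun hx => (hE.mem _ hx).2.2.2 rfl⟩
      rcases hE.null with ⟨_, hl⟩ | ⟨h1, _⟩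
      · exact hl
      · omega
    rintro τ t ⟨hv, ha, hn, L', N', hh, hL, ht⟩
    have hL : ∀ a ∈ L, a ∉ E → a ∈ L' := fun a haL haE => hL a haL (.inr haE)
    have hwL : τ.var .w ∈ L' := by
      rw [hv]
      exact hL _ h.live fun hx => (hE.mem _ hx).2.2.2 rfl
    have fin : ∀ τ' t' N'', τ'.var = τ.var → Agree τ.mem τ'.mem → τ'.mem .next = τ.mem .next →
        Heap τ'.mem L' N'' → t' + 20 * N'' ≤ 20 * N' + 200 →
        StepPost n cells m₀ L₀ (σ.var .w) (σ.var .c)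
          (unvisitedCredit n cells σ.mem + credit L N + 400 * I.length + 1500) τ' (t + t') := by
      intro τ' t' N'' hv' ha' hn' hh' ht'
      refine ⟨by rw [hv', hv], by rw [hv', hv], L', N'', D, I,
        h.update (ha.trans ha') (fun _ _ => by rw [hn', hn]) hh' ?_ ?_ ?_, ?_⟩
      · intro a haL haL'
        by_contra hc
        exact haL' (hL a haL fun haE => hc (hE.mem a haE).2)
      · rw [hn', hn]
        exact h.path
      · intro x hx
        obtain ⟨h1, h2⟩ := h.mem_path x hx
        exact ⟨hL x h1 fun hxE => hE.disjoint x hxE hx, h2⟩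
      · rw [unvisitedCredit_congr (ha.trans ha').dfs]
        unfold credit at *
        omega
    rw [run_when]
    refine ⟨fun _ => ?_, fun _ => ?_⟩
    · refine (run_addEar hh hwL).mono ?_
      rintro τ' t' ⟨hv', ha', hn', N'', hh', ht'⟩
      refine (fin τ' t' N'' hv' ha' hn' hh' (by omega)).mono ?_
      simp [lexLt, isDescendant]
      omega
    · refine (fin τ 0 N' rfl (.refl _) rfl hh (by omega)).mono ?_
      simp [lexLt, isDescendant]
      omega
  · rw [run_seq]
    refine (run_absorbEar (w := .var .w) (u := .get .next (.var .w)) (null := 0) (E := D)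
      h.inv.heap h.live
      (fun _ => ⟨h.path, fun a ha => (h.mem_path a ha).1, h.not_mem_path⟩) (by simp)).mono ?_
    rintro τ t ⟨hv, ha, hn, L', N', hh, hL, ht⟩
    simp at hL
    have fin : ∀ k, LinkedCells (σ.mem .next) k E → ∀ τ' t' : _, τ'.var = τ.var →
        Agree τ.mem τ'.mem → τ'.mem .next = Function.update (τ.mem .next) (σ.var .w) k →
        Heap τ'.mem L' N' → t' ≤ 200 → StepPost n cells m₀ L₀ (σ.var .w) (σ.var .c)
          (unvisitedCredit n cells σ.mem + credit L N + 400 * I.length + 1500) τ' (t + t') := by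
      intro k hk τ' t' hv' ha' hn' hh' ht'
      refine ⟨by rw [hv', hv], by rw [hv', hv], L', N', E, I,
        h.update (ha.trans ha') ?_ hh' ?_ ?_ ?_, ?_⟩
      · intro a haw
        rw [hn', Function.update_of_ne haw, hn]
      · intro a haL haL'
        by_contra hc
        exact haL' (hL a haL fun haD => hc (h.mem_path a haD).2)
      · rw [hn', Function.update_self, hn]
        -- The only link that changes is that of `w`, which is not on `E`.
        exact hk.congr fun x hx => Function.update_of_ne (hE.mem x hx).2.2.2 _ _
      · exact fun x hx => ⟨hL x (hE.mem x hx).1 (hE.disjoint x hx), (hE.mem x hx).2⟩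
      · rw [unvisitedCredit_congr (ha.trans ha').dfs]
        omega
    simp only [run_seq, run_ite, run_set]
    refine ⟨fun h0 => ?_, fun h0 => ?_⟩
    · have hE0 : E = [] := by
        rcases hE.null with ⟨h1, _⟩ | ⟨_, h1⟩
        · simp [hv, h1] at h0
        · exact h1
      refine (fin 0 (hE0 ▸ .nil) _ 20 ?_ ?_ ?_ (hh.congr ?_ ?_ ?_ ?_) (by omega)).mono ?_
      any_goals simp [hv]
      · constructor <;> simp
      · simp [lexLt, isDescendant]
        omega
    · have hl : LinkedCells (σ.mem .next) (σ.var .u) E := by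
        rcases hE.null with ⟨_, h1⟩ | ⟨h1, _⟩
        · exact h1
        · simp [hv, h1] at h0
      refine (fin _ hl _ 20 ?_ ?_ ?_ (hh.congr ?_ ?_ ?_ ?_) (by omega)).mono ?_
      any_goals simp [hv]
      · constructor <;> simp
      · simp [lexLt, isDescendant]
        omega

theorem run_ejectChild {u : ℕ} (h : Loc n cells m₀ L₀ w σ.mem L N D I) (hu : σ.var .u = u)
    (hnull : σ.var .null = 0) (hu0 : u ≠ 0) (hE : Handed m₀ σ.mem w L D (u :: E) u 0) :
    Run ejectChild σ fun τ t => τ.var .w = σ.var .w ∧ τ.var .c = σ.var .c ∧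
      ∃ L' N' E', Loc n cells m₀ L₀ w τ.mem L' N' D I ∧
        Handed m₀ τ.mem w L' D E' (τ.var .u) (τ.var .null) ∧
        t + unvisitedCredit n cells τ.mem + credit L' N' ≤
          unvisitedCredit n cells σ.mem + credit L N + 500 := by
  subst hu
  have hl : LinkedCells (σ.mem .next) (σ.var .u) (σ.var .u :: E) := by simpa using hE.null
  have hlE : LinkedCells (σ.mem .next) (σ.mem .next (σ.var .u)) E := by
    obtain ⟨_, he, hl⟩ := hl.eq_cons hu0
    obtain ⟨-, rfl⟩ := List.cons.inj he
    exact hl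
  have huE : σ.var .u ∉ E := (List.nodup_cons.1 hl.nodup).1
  obtain ⟨huL, hu⟩ := hE.mem _ (List.mem_cons_self)
  rw [ejectChild, run_when]
  refine ⟨fun _ => ?_, fun _ => ?_⟩
  · refine (run_genAuxEdges h.inv.heap huL hnull).mono ?_
    rintro τ t ⟨hvw, hvc, -, hd, ha, hn, N', hh, ht⟩
    have hL : ∀ a ∈ L, a ≠ σ.var .u → a ∈ L.erase (σ.var .u) := fun a haL hau =>
      Finset.mem_erase.2 ⟨hau, haL⟩
    have hloc : Loc n cells m₀ L₀ w τ.mem (L.erase (σ.var .u)) N' D I := by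
      refine h.update ha (fun _ _ => by rw [hn]) hh ?_ (by rw [hn]; exact h.path) ?_
      · intro a haL haL'
        by_cases hau : a = σ.var .u
        · rwa [hau]
        · exact absurd (hL a haL hau) haL'
      · intro x hx
        obtain ⟨h1, h2⟩ := h.mem_path x hx
        refine ⟨hL x h1 ?_, h2⟩
        rintro rfl
        exact hE.disjoint _ List.mem_cons_self hx
    have hcost : (Cond.lt (.get .deg (.var .u)) 3).cost + t + 1 + unvisitedCredit n cells τ.mem +
        credit (L.erase (σ.var .u)) N' ≤
          unvisitedCredit n cells σ.mem + credit L N + 500 := by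
      have := credit_erase huL N
      rw [unvisitedCredit_congr ha.dfs]
      simp
      unfold credit at *
      omega
    rcases hd with hd | ⟨hd, hdu⟩
    -- If `Null` is set, the path handed over is empty. Any vertices behind the ejected one simply
    -- stay live: being live does not require lying on a path.
    · exact ⟨hvw, hvc, _, N', [], hloc, ⟨.inr ⟨hd, rfl⟩, by simp, by simp⟩, hcost⟩
    · refine ⟨hvw, hvc, _, N', E, hloc, ⟨.inl ⟨hd, ?_⟩, ?_, ?_⟩, hcost⟩
      · rw [hn, hdu]
        exact hlE
      · intro x hx
        obtain ⟨h1, h2⟩ := hE.mem x (List.mem_cons_of_mem _ hx)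
        refine ⟨hL x h1 ?_, by rwa [ha.dfs]⟩
        rintro rfl
        exact huE hx
      · exact fun x hx => hE.disjoint x (List.mem_cons_of_mem _ hx)
  · refine ⟨rfl, rfl, L, N, _, h, hnull.symm ▸ hE, ?_⟩
    simp
    omega

/-- The specification of `constructAuxSubgraph` when less than `k` vertices are unvisited. -/
def ConstructSpec (n : ℕ) (cells : ℕ → List ℕ) (k : ℕ) : Prop :=
  ∀ (σ : State) (L : Finset ℕ) (N : ℕ), Inv n cells σ.mem L N → σ.var .w ∈ Finset.Icc 1 n →
    σ.mem .dfs (σ.var .w) = 0 → ((Finset.Icc 1 n).filter fun a => σ.mem .dfs a = 0).card < k →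
    Run constructAuxSubgraphBody σ fun τ t => ∃ L' N' D I,
      Loc n cells σ.mem L (σ.var .w) τ.mem L' N' D I ∧
      t + unvisitedCredit n cells τ.mem + credit L' N' ≤
        unvisitedCredit n cells σ.mem + credit L N

/-- The recursive call costs nothing beyond the potential, and ejection and merging cost constants.
The child together with the path it computed is the path handed over. -/
theorem run_processChild {k : ℕ} (hrec : ConstructSpec n cells k)
    (h : Loc n cells m₀ L₀ w σ.mem L N D I) (hw : σ.var .w = w)
    (hu : σ.var .u ∈ Finset.Icc 1 n) (hu0 : σ.mem .dfs (σ.var .u) = 0)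
    (hk : ((Finset.Icc 1 n).filter fun a => m₀ .dfs a = 0).card ≤ k) :
    Run processChild σ (StepPost n cells m₀ L₀ w (σ.var .c)
      (unvisitedCredit n cells σ.mem + credit L N + 400 * I.length + 4000)) := by
  subst hw
  -- Visiting `w` made the number of unvisited vertices drop strictly, which permits the induction
  -- hypothesis.
  have hcard : ((Finset.Icc 1 n).filter fun a => σ.mem .dfs a = 0).card < k := by
    refine (Finset.card_lt_card ?_).trans_le hk
    refine Finset.ssubset_iff_of_subset (fun a ha => ?_) |>.2 ⟨σ.var .w, ?_, ?_⟩
    · rw [Finset.mem_filter] at ha ⊢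
      exact ⟨ha.1, h.new ha.2⟩
    · exact Finset.mem_filter.2 ⟨h.vertex, h.fresh⟩
    · simp [h.visited]
  rw [processChild_eq, run_seq, run_assign, run_seq, run_call]
  refine Run.mono (hrec _ L N h.inv (by simpa using hu) (by simpa using hu0) hcard) ?_
  rintro τ t ⟨L', N', E, J, h', ht⟩
  simp at h' ht
  rw [run_seq, run_set, run_seq]
  have hloc := h.child h'
  have hag : ∀ k, Agree τ.mem (Function.update τ.mem .nd k) := fun k => by constructor <;> simp
  have hheap : ∀ k, Heap (Function.update τ.mem .nd k) L' N' := fun k =>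
    h'.inv.heap.congr (by simp) (by simp) (by simp) (by simp)
  refine (run_ejectChild (u := σ.var .u) (E := E) (hloc.update (L' := L') (N' := N') (D' := D) (hag _) (by simp)
    (hheap _) (fun a ha hc => absurd ha hc) (by simpa using hloc.path) hloc.mem_path)
    (by simp) (by simp) ?_ ?_).mono ?_
  · have := (Finset.mem_Icc.1 hu).1
    omega
  · refine ⟨.inl ⟨rfl, ?_⟩, ?_, ?_⟩
    · refine .cons ?_ ?_
      · have := (Finset.mem_Icc.1 hu).1
        omega
      · simpa using h'.path
    · intro x hx
      rcases List.mem_cons.1 hx with rfl | hx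
      · refine ⟨h'.live, h.new hu0, by simpa using h'.visited, ?_⟩
        intro hc
        exact h.visited (hc ▸ hu0)
      · obtain ⟨h1, h2, h3, h4⟩ := h'.mem_path x hx
        refine ⟨h1, h.new h2, by simpa using h3, ?_⟩
        rintro rfl
        exact h.visited h2
    -- Vertices of `D` were visited before the call and those of `u :: E` were not, so the two paths
    -- are disjoint.
    · intro x hx hxD
      obtain ⟨h1, h2, h3, h4⟩ := h.mem_path x hxD
      rcases List.mem_cons.1 hx with rfl | hx
      · exact h3 hu0
      · exact h3 (h'.mem_path x hx).2.1
  rintro τ' t' ⟨hvw, hvc, L'', N'', E', hloc', hE', ht'⟩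
  simp at hvw hvc
  refine (run_mergeChild hloc' hvw hE').mono ?_
  intro τ'' t'' hpost
  rw [hvc] at hpost
  refine hpost.mono ?_
  have hU : ∀ k, unvisitedCredit n cells (Function.update τ.mem .nd k) =
      unvisitedCredit n cells τ.mem := fun k => unvisitedCredit_congr (by simp)
  simp only [State.setMem, hU] at ht'
  simp
  omega

end

/-! ### The adjacency loop, the loop over `Inc(w)`, and the recursion. -/

section

variable {n : ℕ} {cells : ℕ → List ℕ} {m₀ : Arr → ℕ → ℕ} {L₀ L : Finset ℕ}
  {w N : ℕ} {D I E : List ℕ} {σ : State}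

/-- The processing of one entry of the adjacency list of `w`. -/
def processEntry : Cmd :=
  .seq (.assign .u (.get .adjVertex (.var .c)))
  (.seq (.set .deg (.var .w) (.get .deg (.var .w) + 1))
  (.seq (.ite (.eq (.get .dfs (.var .u)) 0) processChild
    (.ite (.and (.lt (.get .dfs (.var .u)) (.get .dfs (.var .w)))
        (neq (.get .adjEdge (.var .c)) (.var .e)))
      processOutgoing
      (when (neq (.get .adjEdge (.var .c)) (.var .e)) (addInc (.var .w) (.var .u)))))
    (.assign .c (.get .adjLink (.var .c)))))

/-- The processing of the list `Inc(w)`. -/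
def processInc : Cmd :=
  .while (neq (.var .c) 0)
    (.seq (.call .absorbSubpath [(.w, .var .w), (.u, .get .incVertex (.var .c))] [])
      (.assign .c (.get .incLink (.var .c))))

theorem constructAuxSubgraphBody_eq : constructAuxSubgraphBody =
    .seq (.set .dfs (.var .w) (.get .cnt 0))
    (.seq (.set .cnt 0 (.get .cnt 0 + 1))
    (.seq (.set .parent (.var .w) (.var .v))
    (.seq (.set .next (.var .w) 0)
    (.seq (.set .earS (.var .w) 0)
    (.seq (.set .earT (.var .w) 0)
    (.seq (.assign .c (.get .adjHead (.var .w)))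
    (.seq (.while (neq (.var .c) 0) processEntry)
    (.seq (.assign .c (.get .incHead (.var .w))) processInc)))))))) := rfl

theorem run_processEntry {k : ℕ} (hrec : ConstructSpec n cells k)
    (h : Loc n cells m₀ L₀ w σ.mem L N D I) (hw : σ.var .w = w)
    (hu : σ.mem .adjVertex (σ.var .c) ∈ Finset.Icc 1 n)
    (hk : ((Finset.Icc 1 n).filter fun a => m₀ .dfs a = 0).card ≤ k) :
    Run processEntry σ fun τ t => τ.var .w = w ∧ τ.var .c = m₀ .adjLink (σ.var .c) ∧
      ∃ L' N' D' I', Loc n cells m₀ L₀ w τ.mem L' N' D' I' ∧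
        t + unvisitedCredit n cells τ.mem + credit L' N' + 400 * I'.length ≤
          unvisitedCredit n cells σ.mem + credit L N + 400 * I.length + 4500 := by
  rw [processEntry, run_seq, run_assign, run_seq, run_set, run_seq]
  set ρ : State := ((σ.setVar .u (Expr.eval σ (.get .adjVertex (.var .c)))).setMem .deg
    (Expr.eval (σ.setVar .u (Expr.eval σ (.get .adjVertex (.var .c)))) (.var .w))
    (Expr.eval (σ.setVar .u (Expr.eval σ (.get .adjVertex (.var .c))))
      (.get .deg (.var .w) + 1))) with hρ
  have hag : Agree σ.mem ρ.mem := by constructor <;> simp [hρ]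
  have hloc : Loc n cells m₀ L₀ w ρ.mem L N D I := h.update hag (by simp [hρ])
    (h.inv.heap.congr (by simp [hρ]) (by simp [hρ]) (by simp [hρ]) (by simp [hρ]))
    (fun a ha hc => absurd ha hc) (by simpa [hρ] using h.path) h.mem_path
  have hU : unvisitedCredit n cells ρ.mem = unvisitedCredit n cells σ.mem :=
    unvisitedCredit_congr hag.dfs
  have hρw : ρ.var .w = w := by simpa [hρ] using hw
  have hρc : ρ.var .c = σ.var .c := by simp [hρ]
  have hρu : ρ.var .u ∈ Finset.Icc 1 n := by simpa [hρ] using hu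
  -- From here on only the recorded facts about the intermediate state are used, and all branches of
  -- the test share them.
  clear_value ρ
  have step : Run (.ite (.eq (.get .dfs (.var .u)) 0) processChild
      (.ite (.and (.lt (.get .dfs (.var .u)) (.get .dfs (.var .w)))
        (neq (.get .adjEdge (.var .c)) (.var .e)))
      processOutgoing
      (when (neq (.get .adjEdge (.var .c)) (.var .e)) (addInc (.var .w) (.var .u))))) ρ
      (StepPost n cells m₀ L₀ w (ρ.var .c)
        (unvisitedCredit n cells ρ.mem + credit L N + 400 * I.length + 4200)) := by
    rw [run_ite]
    refine ⟨fun h0 => ?_, fun _ => ?_⟩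
    · refine (run_processChild hrec hloc hρw hρu (by simpa using h0) hk).mono fun τ t h => h.mono ?_
      simp
      omega
    · rw [run_ite]
      refine ⟨fun _ => ?_, fun _ => ?_⟩
      · refine (run_processOutgoing hloc hρw).mono fun τ t h => h.mono ?_
        simp
        omega
      · rw [run_when]
        refine ⟨fun _ => ?_, fun _ => ?_⟩
        · refine (run_addInc hloc hρw).mono fun τ t h => h.mono ?_
          simp
          omega
        · refine ⟨hρw, rfl, L, N, D, I, hloc, ?_⟩
          simp
          omega
  refine step.mono ?_
  rintro τ t ⟨h1, h2, L', N', D', I', hl, ht⟩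
  rw [run_assign]
  refine ⟨by simpa using h1, ?_, L', N', D', I', hl, ?_⟩
  · simp [hl.ext.adjLink, h2, hρc]
  · rw [hU] at ht
    simp
    omega

/-- The adjacency arrays are never written, so the list fixed at the start of the processing of `w`
is the one traversed despite the recursive calls. Each entry is charged 5000, namely 4500 for its
processing and the rest for the loop test. -/
theorem run_processEntries {k : ℕ} (hrec : ConstructSpec n cells k)
    (hk : ((Finset.Icc 1 n).filter fun a => m₀ .dfs a = 0).card ≤ k) {cs : List ℕ}
    (h : Loc n cells m₀ L₀ w σ.mem L N D I) (hw : σ.var .w = w)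
    (hc : LinkedCells (m₀ .adjLink) (σ.var .c) cs)
    (hcs : ∀ j ∈ cs, m₀ .adjVertex j ∈ Finset.Icc 1 n) :
    Run (.while (neq (.var .c) 0) processEntry) σ fun τ t => τ.var .w = w ∧
      ∃ L' N' D' I', Loc n cells m₀ L₀ w τ.mem L' N' D' I' ∧
        t + unvisitedCredit n cells τ.mem + credit L' N' + 400 * I'.length ≤
          unvisitedCredit n cells σ.mem + credit L N + 400 * I.length + 5000 * cs.length + 10 := by
  induction cs generalizing σ L N D I with
  | nil =>
    have h0 : σ.var .c = 0 := by
      by_contra h0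
      obtain ⟨_, h, -⟩ := hc.eq_cons h0
      simp at h
    rw [run_while]
    refine ⟨fun h1 => by simp [h0] at h1, fun _ => ⟨hw, L, N, D, I, h, ?_⟩⟩
    simp
    omega
  | cons j cs ih =>
    rw [run_while]
    generalize hj : σ.var .c = i at hc
    cases hc with
    | cons hj0 hc =>
      subst hj
      refine ⟨fun _ => ?_, fun h1 => by simp [hj0] at h1⟩
      refine (run_processEntry hrec h hw ?_ hk).mono ?_
      · rw [h.ext.adjVertex]
        exact hcs _ List.mem_cons_self
      rintro τ t ⟨hv, hc', L', N', D', I', h', ht⟩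
      refine (ih h' hv (by rwa [hc']) fun j hj => hcs j (List.mem_cons_of_mem _ hj)).mono ?_
      rintro τ' t' ⟨hv', L'', N'', D'', I'', h'', ht'⟩
      refine ⟨hv', L'', N'', D'', I'', h'', ?_⟩
      simp
      omega

/-- The credit of 400 per cell pays for the constant overhead of `absorbSubpath` and the loop; the
absorptions themselves are paid by the vertices that die. -/
theorem run_processInc {J : List ℕ} (h : Loc n cells m₀ L₀ w σ.mem L N D I)
    (hw : σ.var .w = w) (hc : LinkedCells (σ.mem .incLink) (σ.var .c) J) :
    Run processInc σ fun τ t => ∃ L' N' D', Loc n cells m₀ L₀ w τ.mem L' N' D' I ∧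
      t + unvisitedCredit n cells τ.mem + credit L' N' ≤
        unvisitedCredit n cells σ.mem + credit L N + 400 * J.length + 10 := by
  induction J generalizing σ L N D with
  | nil =>
    have h0 : σ.var .c = 0 := by
      by_contra h0
      obtain ⟨_, h, -⟩ := hc.eq_cons h0
      simp at h
    rw [processInc, run_while]
    refine ⟨fun h1 => by simp [h0] at h1, fun _ => ⟨L, N, D, h, ?_⟩⟩
    simp
    omega
  | cons j J ih =>
    rw [processInc, run_while]
    generalize hj : σ.var .c = i at hc
    cases hc with
    | cons hj0 hc =>
      subst hj
      refine ⟨fun _ => ?_, fun h1 => by simp [hj0] at h1⟩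
      rw [run_seq]
      subst hw
      refine (run_absorbSubpath h.inv.heap h.live h.path (fun a ha => (h.mem_path a ha).1)
        h.not_mem_path (by simp)).mono ?_
      rintro τ t ⟨hv, ha, hn, D', L', N', hp, hD', hsub, hL, hh, ht⟩
      rw [run_assign]
      have h' : Loc n cells m₀ L₀ (σ.var .w) τ.mem L' N' D' I := by
        refine h.update ha hn hh ?_ hp fun x hx => ⟨hD' x hx, (h.mem_path x (hsub x hx)).2⟩
        intro a haL haL'
        by_contra hc
        exact haL' (hL a haL fun haD => hc (h.mem_path a haD).2)
      refine (ih (by simpa using h') (by simp [hv]) (by simpa [ha.incLink, hv] using hc)).mono ?_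
      rintro τ' t' ⟨L'', N'', D'', h'', ht'⟩
      refine ⟨L'', N'', D'', h'', ?_⟩
      simp [unvisitedCredit_congr ha.dfs] at ht' ⊢
      omega

/-- The visit of `w` releases 5000 and 5000 per adjacency entry. The latter pay for the adjacency
loop, the former for the constant work around the two loops, and the credit collected in `Inc(w)`
for the second loop. -/
theorem constructSpec (n : ℕ) (cells : ℕ → List ℕ) (k : ℕ) : ConstructSpec n cells k := by
  induction k with
  | zero => exact fun _ _ _ _ _ _ h => absurd h (Nat.not_lt_zero _)
  | succ k ih =>
    intro σ L N hinv hw h0 hk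
    rw [constructAuxSubgraphBody_eq, run_seq, run_set, run_seq, run_set, run_seq, run_set, run_seq,
      run_set, run_seq, run_set, run_seq, run_set, run_seq, run_assign, run_seq]
    obtain ⟨hlive, hinc⟩ := hinv.fresh _ hw h0
    have hcnt := hinv.cnt_pos
    have hne : ∀ a, σ.mem .dfs a ≠ 0 → a ≠ σ.var .w := by
      rintro a ha rfl
      exact ha h0
    refine (run_processEntries (L₀ := L) (m₀ := σ.mem) (w := σ.var .w) (L := L) (N := N) (D := [])
      (I := []) (cs := cells (σ.var .w)) ih (by omega) ?_ (by simp) ?_ (hinv.vertex _ hw)).mono ?_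
    · refine ⟨⟨hinv.heap.congr ?_ ?_ ?_ ?_, ?_, ?_, ?_, ?_⟩,
        ⟨?_, ?_, ?_, ?_, ?_, ?_, ?_, ?_, ?_⟩, hw, h0, ?_, hlive, ?_, ?_, ?_, ?_⟩
      any_goals simp
      · intro a h1 h2 h3
        rcases eq_or_ne a (σ.var .w) with rfl | haw
        · rw [Function.update_self] at h3
          omega
        · rw [Function.update_of_ne haw] at h3
          exact hinv.fresh a (Finset.mem_Icc.2 ⟨h1, h2⟩) h3
      · simpa using hinv.adj
      · simpa using hinv.vertex
      · exact fun a ha => Function.update_of_ne (hne a ha) _ _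
      · exact fun a ha => Function.update_of_ne (hne a ha) _ _
      · exact fun a ha _ => ha
      · omega
      · exact .nil
      · rw [hinc]
        exact .nil
    · simpa using hinv.adj _ hw
    rintro τ t ⟨hv, L', N', D, I, h, ht⟩
    rw [run_seq, run_assign]
    refine (run_processInc (σ := τ.setVar .c _) h (by simpa using hv) (J := I) ?_).mono ?_
    · simpa [hv] using h.inc
    rintro τ' t' ⟨L'', N'', D', h', ht'⟩
    refine ⟨L'', N'', D', I, h', ?_⟩
    -- The initial potential is split into the share released by `w` and the potential after
    -- `dfs(w)` has been set; the later writes do not touch `dfs`.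
    rw [← unvisitedCredit_visit (m' := Function.update σ.mem .dfs
      (Function.update (σ.mem .dfs) (σ.var .w) (σ.mem .cnt 0))) hw h0 hcnt.ne' (by simp)]
    simp at ht ht' ⊢
    rw [unvisitedCredit_congr (m' := Function.update _ Arr.earT _) (m := Function.update σ.mem .dfs
      (Function.update (σ.mem .dfs) (σ.var .w) (σ.mem .cnt 0)))] at ht
    · omega
    · simp

end

/-! ### Initialization, counting of adjacency entries, and the total. -/

/-! ### The main program -/

/-- The initialization of the vertex `i`. -/
def initVertex : Cmd :=
  .seq (.set .dfs (.var .i) 0)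
  (.seq (.set .deg (.var .i) 0)
  (.seq (.set .nd (.var .i) 1)
  (.seq (.set .parent (.var .i) 0)
  (.seq (.set .alphaHead (.var .i) 0)
  (.seq (.set .incHead (.var .i) 0)
    (.assign .i (.var .i + 1)))))))

theorem auxiliary3eccSubgraphs_eq : auxiliary3eccSubgraphs =
    .seq (.assign .i 1)
    (.seq (.while (.lt (.var .i) (.var .n + 1)) initVertex)
    (.seq (.set .free 0 1)
    (.seq (.set .cnt 0 1)
    (.seq (.call .constructAuxSubgraph [(.w, .var .r), (.v, 0), (.e, 0)] [])
      (.call .output [(.u, .var .r)] []))))) := rfl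

/-- The vertices below `i` are initialized, and the input is unchanged. -/
structure Init (n r : ℕ) (m₀ : Arr → ℕ → ℕ) (i : ℕ) (σ : State) : Prop where
  n_eq : σ.var .n = n
  r_eq : σ.var .r = r
  i_eq : σ.var .i = i
  adjHead : σ.mem .adjHead = m₀ .adjHead
  adjVertex : σ.mem .adjVertex = m₀ .adjVertex
  adjLink : σ.mem .adjLink = m₀ .adjLink
  zero : ∀ a, 1 ≤ a → a < i → σ.mem .dfs a = 0 ∧ σ.mem .alphaHead a = 0 ∧ σ.mem .incHead a = 0

theorem run_init {n r : ℕ} {m₀ : Arr → ℕ → ℕ} {i : ℕ} {σ : State} (h : Init n r m₀ i σ)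
    (hi : i ≤ n + 1) :
    Run (.while (.lt (.var .i) (.var .n + 1)) initVertex) σ fun τ t =>
      Init n r m₀ (n + 1) τ ∧ t ≤ 60 * (n + 1 - i) + 10 := by
  induction hj : n + 1 - i generalizing i σ with
  | zero =>
    obtain rfl : i = n + 1 := by omega
    rw [run_while]
    refine ⟨fun h1 => by simp [h.n_eq, h.i_eq] at h1, fun _ => ⟨h, by simp⟩⟩
  | succ j ih =>
    rw [run_while]
    refine ⟨fun _ => ?_, fun h1 => ?_⟩
    · simp only [initVertex, run_seq, run_set, run_assign]
      refine (ih (i := i + 1) ?_ (by omega) (by omega)).mono ?_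
      · refine ⟨?_, ?_, ?_, ?_, ?_, ?_, ?_⟩
        · simpa using h.n_eq
        · simpa using h.r_eq
        · simpa using h.i_eq
        · simpa using h.adjHead
        · simpa using h.adjVertex
        · simpa using h.adjLink
        · intro a ha hai
          simp only [State.setVar, State.setMem, Expr.eval, h.i_eq]
          rcases eq_or_ne a i with rfl | hne
          · simp
          · simpa [hne] using h.zero a ha (by omega)
      · rintro τ t ⟨h', ht⟩
        refine ⟨h', ?_⟩
        simp
        omega
    · simp [h.n_eq, h.i_eq] at h1
      omega

/-- Double counting: the map from entries to edges has fibres of size at most two, since an edge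
joining `x` and `y` occurs only in the entries from `x` to `y` and from `y` to `x`; these coincide
for a loop. -/
theorem sum_length_le {G : Graph ℕ ℕ} {V : Finset ℕ} {k : ℕ} {l : ℕ → List (ℕ × ℕ)}
    (hE : G.edgeSet = Set.Icc 1 k) (hnd : ∀ a ∈ V, (l a).Nodup)
    (hl : ∀ a ∈ V, ∀ f b, (f, b) ∈ l a ↔ G.IsLink f a b) :
    ∑ a ∈ V, (l a).length ≤ 2 * k := by
  have h : ∑ a ∈ V, (l a).length = (V.sigma fun a => (l a).toFinset).card := by
    rw [Finset.card_sigma]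
    exact Finset.sum_congr rfl fun a ha => (List.toFinset_card_of_nodup (hnd a ha)).symm
  have hk : (Finset.Icc 1 k).card = k := by simp
  rw [h]
  conv_rhs => rw [← hk]
  have mem : ∀ z ∈ V.sigma fun a => (l a).toFinset, G.IsLink z.2.1 z.1 z.2.2 := by
    rintro ⟨a, f, b⟩ hz
    rw [Finset.mem_sigma, List.mem_toFinset] at hz
    exact (hl a hz.1 f b).1 hz.2
  refine Finset.card_le_mul_card_image_of_maps_to (f := fun z => z.2.1) (fun z hz => ?_) 2 ?_
  · have := (mem z hz).edge_mem
    rw [hE] at this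
    simpa using this
  · intro f _
    rcases Finset.eq_empty_or_nonempty
      {z ∈ V.sigma fun a => (l a).toFinset | z.2.1 = f} with he | ⟨⟨x, f', y⟩, hz⟩
    · rw [he]
      simp
    · obtain ⟨hz₁, rfl⟩ := Finset.mem_filter.1 hz
      have hxy : G.IsLink f' x y := mem _ hz₁
      refine (Finset.card_le_card (t := {⟨x, f', y⟩, ⟨y, f', x⟩}) ?_).trans Finset.card_le_two
      rintro ⟨a, f, b⟩ hz'
      obtain ⟨hz₂, hf⟩ := Finset.mem_filter.1 hz'
      obtain rfl : f = f' := hf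
      have hab : G.IsLink f a b := mem ⟨a, f, b⟩ hz₂
      rcases hxy.eq_and_eq_or_eq_and_eq hab with ⟨rfl, rfl⟩ | ⟨rfl, rfl⟩ <;> simp

theorem unvisitedCredit_le (n : ℕ) (cells : ℕ → List ℕ) (m : Arr → ℕ → ℕ) :
    unvisitedCredit n cells m ≤
      5000 * n + 5000 * ∑ a ∈ Finset.Icc 1 n, (cells a).length := by
  refine (Finset.sum_le_sum_of_subset (Finset.filter_subset _ _)).trans ?_
  rw [Finset.sum_add_distrib, ← Finset.mul_sum]
  simp
  omega

/-- At the start all vertices are live with empty lists, so the potential is at most 5200 per vertex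
plus 5000 per adjacency entry. The other 800 per vertex absorb initialization and the constants, as
there is at least one vertex. -/
theorem run_main {n r : ℕ} {cells : ℕ → List ℕ} {σ : State} (hn : σ.var .n = n)
    (hr : σ.var .r = r) (hrn : r ∈ Finset.Icc 1 n)
    (hadj : ∀ a ∈ Finset.Icc 1 n, LinkedCells (σ.mem .adjLink) (σ.mem .adjHead a) (cells a))
    (hver : ∀ a ∈ Finset.Icc 1 n, ∀ k ∈ cells a, σ.mem .adjVertex k ∈ Finset.Icc 1 n) :
    Run auxiliary3eccSubgraphs σ fun _ t =>
      t ≤ 6000 * n + 5000 * ∑ a ∈ Finset.Icc 1 n, (cells a).length := by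
  have hr1 := Finset.mem_Icc.1 hrn
  rw [auxiliary3eccSubgraphs_eq, run_seq, run_assign, run_seq]
  refine (run_init (n := n) (r := r) (m₀ := σ.mem) (i := 1) ?_ (by omega)).mono ?_
  · exact ⟨by simpa using hn, by simpa using hr, by simp, rfl, rfl, rfl, by omega⟩
  rintro τ t ⟨h, ht⟩
  rw [run_seq, run_set, run_seq, run_set, run_seq, run_call]
  refine Run.mono (constructSpec n cells (n + 1) _ (Finset.Icc 1 n) 0 ?_ ?_ ?_ ?_) ?_
  · refine ⟨⟨fun _ => [], ⟨?_, ?_, ?_, ?_, ?_⟩, ?_⟩, ?_, ?_, ?_, ?_⟩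
    any_goals simp
    · intro a h1 h2
      rw [(h.zero a h1 (by omega)).2.1]
      exact .nil
    · intro a h1 h2 _
      exact ⟨⟨h1, h2⟩, (h.zero a h1 (by omega)).2.2⟩
    · rw [h.adjLink, h.adjHead]
      simpa using hadj
    · rw [h.adjVertex]
      simpa using hver
  · simpa [h.r_eq] using hrn
  · simpa [h.r_eq] using (h.zero r hr1.1 (by omega)).1
  · refine Nat.lt_succ_of_le ((Finset.card_filter_le _ _).trans ?_)
    simp
  · rintro τ' t' ⟨L, N, D, I, hl, ht'⟩
    refine Run.mono (run_output (x := .r) hl.inv.heap (by simpa using hl.live)) ?_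
    rintro τ'' t'' ⟨-, -, N', -, ht''⟩
    have := unvisitedCredit_le n cells (State.setMem (τ.setMem .free 0 1) .cnt 0 1).mem
    simp [credit] at *
    omega

end Aux3ecc

open Aux3ecc in
theorem mainTheorem2 :
    ∃ C : ℕ, ∀ (G : Graph ℕ ℕ) (root : ℕ) (σ : Aux3ecc.State),
      Aux3ecc.Connected G → Aux3ecc.IsInput G root σ →
      ∃ (τ : Aux3ecc.State) (t : ℕ),
        Aux3ecc.Exec Aux3ecc.procedures Aux3ecc.auxiliary3eccSubgraphs σ τ t ∧
        t ≤ C * (G.vertexSet.ncard + G.edgeSet.ncard) := by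
  -- An edge accounts for at most two adjacency entries at 5000 each; the 6000 per vertex fit below
  -- the same constant.
  refine ⟨10000, fun G root σ _ h => ?_⟩
  have hV : ∀ a, a ∈ Finset.Icc 1 (σ.var .n) ↔ a ∈ G.vertexSet := fun a => by
    rw [h.vertexSet_eq, Finset.mem_Icc, Set.mem_Icc]
  have hlist := h.adjacencyList
  choose! cells hcells using hlist
  obtain ⟨τ, t, hx, ht⟩ := run_main (cells := cells) rfl h.root_eq ((hV _).2 h.root_mem)
    (fun a ha => (hcells a ((hV a).1 ha)).1) fun a ha k hk => by
      have hm := ((hcells a ((hV a).1 ha)).2.2 (σ.mem .adjEdge k) (σ.mem .adjVertex k)).1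
        (List.mem_map.2 ⟨k, hk, rfl⟩)
      exact (hV _).2 hm.right_mem
  have hsum := sum_length_le (V := Finset.Icc 1 (σ.var .n)) h.edgeSet_eq
    (fun a ha => (hcells a ((hV a).1 ha)).2.1) fun a ha => (hcells a ((hV a).1 ha)).2.2
  simp only [List.length_map] at hsum
  have hcard : G.vertexSet.ncard = σ.var .n := by
    rw [h.vertexSet_eq, ← Finset.coe_Icc, Set.ncard_coe_finset]
    simp
  refine ⟨τ, t, hx, ?_⟩
  rw [hcard]
  omega
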